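/- **Architecture.** Write $\sigma(t)=\max(0,t)$, applied entrywise. A *feed-forward network* of depth $L\ge 2$ and width $w$ on $\mathbb R^{e}$ is $h\mapsto W_{L}\sigma(W_{L-1}\cdots\sigma(W_1h+b_1)\cdots+b_{L-1})+b_{L}$ with $W_1\in\mathbb R^{w\times e}$, $W_2,\dots,W_{L-1}\in\mathbb R^{w\times w}$, $W_L\in\mathbb R^{e\times w}$; one of depth $1$ is $h\mapsto W_1h+b_1$ with $W_1\in\mathbb R^{e\times e}$. A *multi-headed attention layer* with $k$ heads maps $X\in\mathbb R^{e\times l}$ (columns are tokens) to $W_O\,\mathrm{concat}_{j\le k}\big(V_jX\,\sigma((K_jX)^{T}Q_jX)\big)$ with $Q_j,K_j,V_j\in\mathbb R^{e\times e}$, $W_O\in\mathbb R^{e\times ke}$. A *transformer block* is $B(X)=\mathrm{FFN}(\mathrm{MHA}(X)+X)+\mathrm{MHA}(X)+X$, with FFN acting on each token. A *transformer* on $\mathbb R^D$ is $T=\mathrm{Dec}\circ B_{L_T}\circ\cdots\circ B_1\circ(\mathrm{PE}+E)$, where $E(x)=E'(Ux)^{T}$ with $U\in\mathbb R^{l\times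 D}$, $E'\in\mathbb R^{e}$, where $\mathrm{PE}\in\mathbb R^{e\times l}$, and where $\mathrm{Dec}$ returns the first entry of the last token. The class $\mathcal T(L_T,L_{\mathrm{FFN}},w_{\mathrm{FFN}},l,d_{embd},m,R,\kappa)$, for a fixed input stage $(U,E',\mathrm{PE})$ with entries of magnitude at most $\kappa$, consists of the transformers with $L_T$ blocks, each with at most $m$ heads and with an FFN of depth at most $L_{\mathrm{FFN}}$ and width $w_{\mathrm{FFN}}$, with $l$ tokens, embedding dimension $e=d_{embd}$, all weights of magnitude at most $\kappa$, and $|T(x)|\le R$ for all $x\in\mathbb R^D$. **Manifolds.** The *reach* of $\mathcal M\subset\mathbb R^D$ is the infimum of the $r>0$ such that there are $x\ne y$ in $\mathcal M$ and $v\in\mathbb R^D$ with $r=\|x-v\|=\|y-v\|=\inf_{z\in\mathcal M}\|z-v\|$ (and $\infty$ if there is no such $r$). For $\tau>0$ we say that $\mathcal M$ is *covered by $N$ charts* if it is contained in $N$ open balls centred at points of $\mathcal M$ with a common radius $r\le\tau/4$; a compact $\mathcal M$ is covered by $N$ charts for some $N$. **Theorem.** Let $D\in\mathbb N$, $C_{\mathcal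 M}\in\mathbb N$, $H_f,\tau>0$ and $0<\beta\le1$. There is a constant $C$ depending only on $C_{\mathcal M},D,H_f,\tau,\beta$, and for all $M,R>0$ there is a constant $C'$ depending only on $C_{\mathcal M},D,H_f,\tau,\beta,M,R$, such that the following holds. Let $d\ge1$ and let $\mathcal M\subset\mathbb R^D$ be a compact smooth $d$-dimensional embedded submanifold without boundary, with the induced Riemannian metric, with $\|x\|_\infty\le M$ for all $x\in\mathcal M$, with reach at least $\tau$, and covered by $C_{\mathcal M}$ charts. Then for every $\epsilon\in(0,1)$ there are a transformer class $\mathcal T(L_T,L_{\mathrm{FFN}},w_{\mathrm{FFN}},l,d_{embd},m,R,\kappa)$ and a fixed input stage with $$L_T\le C(1+\log d),\quad L_{\mathrm{FFN}}\le C(1+\log\epsilon^{-1}),\quad w_{\mathrm{FFN}}\le C,\quad l\le C\,d\,\epsilon^{-d/\beta},$$ $$d_{embd}\le C,\quad m\le C\,d\,\epsilon^{-d/\beta},\quad \kappa\le C'\,d^2\epsilon^{-2d/\beta},$$ such that for every $f:\mathcal M\to\mathbb R$ with $\sup_{\mathcal M}|f|\le R$ that is $\beta$-Hölder with constant $H_f$,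 i.e. $|f(x)-f(y)|\le H_f\,d_{\mathcal M}(x,y)^\beta$ for the geodesic distance $d_{\mathcal M}$ (in particular for every $f$ that is $\beta$-Hölder with constant $H_f$ for the Euclidean distance), some $T$ in the class satisfies $\|T-f\|_{L^\infty(\mathcal M)}\le\epsilon$. -/

import Mathlib

open scoped ENNReal NNReal ContDiff Matrix

noncomputable section

namespace TransformerApprox

/-! ### Transformer networks with ReLU attention -/

/-- The ReLU activation. -/
def relu (t : ℝ) : ℝ := max 0 t

/-- An affine layer `h ↦ W h + b` from `ℝ^p` to `ℝ^q`. -/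
structure AffineLayer (p q : ℕ) where
  W : Matrix (Fin q) (Fin p) ℝ
  b : Fin q → ℝ

namespace AffineLayer

variable {p q : ℕ}

def eval (A : AffineLayer p q) (h : Fin p → ℝ) : Fin q → ℝ := A.W *ᵥ h + A.b

/-- The affine layer followed by the entrywise ReLU. -/
def evalRelu (A : AffineLayer p q) (h : Fin p → ℝ) : Fin q → ℝ := fun i => relu (A.eval h i)

/-- All weights and biases have magnitude at most `κ`. -/
def Bounded (A : AffineLayer p q) (κ : ℝ) : Prop :=
  (∀ i j, |A.W i j| ≤ κ) ∧ ∀ i, |A.b i| ≤ κ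

end AffineLayer

/-- The weights of a feed-forward network `ℝ^e → ℝ^e` with hidden width `w`:
either one affine layer, or `W_L σ(W_{L-1} ⋯ σ(W_1 h + b_1) ⋯ + b_{L-1}) + b_L` with `L ≥ 2`, where
`W_1` is `w × e`, the `L - 2` middle matrices are `w × w`, and `W_L` is `e × w`. -/
inductive FeedForward (e w : ℕ) where
  | single (A : AffineLayer e e)
  | deep (first : AffineLayer e w) (middle : List (AffineLayer w w)) (last : AffineLayer w e)

namespace FeedForward

variable {e w : ℕ}

/-- The number of affine layers. -/
def depth : FeedForward e w → ℕ
  | single _ => 1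
  | deep _ middle _ => middle.length + 2

/-- The action on one token. -/
def eval : FeedForward e w → (Fin e → ℝ) → (Fin e → ℝ)
  | single A, h => A.eval h
  | deep first middle last, h =>
      last.eval (middle.foldl (fun z A => A.evalRelu z) (first.evalRelu h))

def Bounded : FeedForward e w → ℝ → Prop
  | single A, κ => A.Bounded κ
  | deep first middle last, κ => first.Bounded κ ∧ (∀ A ∈ middle, A.Bounded κ) ∧ last.Bounded κ

/-- The token-wise action on an embedding matrix, whose columns are the tokens. -/
def apply {l : ℕ} (F : FeedForward e w) (X : Matrix (Fin e) (Fin l) ℝ) :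
    Matrix (Fin e) (Fin l) ℝ :=
  Matrix.of fun i t => F.eval (fun a => X a t) i

end FeedForward

/-- Query, key and value matrices of one attention head. -/
structure Head (e : ℕ) where
  Q : Matrix (Fin e) (Fin e) ℝ
  K : Matrix (Fin e) (Fin e) ℝ
  V : Matrix (Fin e) (Fin e) ℝ

namespace Head

variable {e : ℕ}

/-- `A(X) = V X σ((K X)ᵀ Q X)`. -/
def attn {l : ℕ} (A : Head e) (X : Matrix (Fin e) (Fin l) ℝ) : Matrix (Fin e) (Fin l) ℝ :=
  A.V * X * ((A.K * X)ᵀ * (A.Q * X)).map relu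

def Bounded (A : Head e) (κ : ℝ) : Prop :=
  (∀ i j, |A.Q i j| ≤ κ) ∧ (∀ i j, |A.K i j| ≤ κ) ∧ ∀ i j, |A.V i j| ≤ κ

end Head

/-- The weights of a transformer block with embedding dimension `e` and feed-forward width `w`. -/
structure Block (e w : ℕ) where
  /-- number of attention heads -/
  heads : ℕ
  head : Fin heads → Head e
  /-- the output matrix `W_O`, of size `e × (heads * e)` -/
  WO : Matrix (Fin e) (Fin heads × Fin e) ℝ
  ffn : FeedForward e w

namespace Block

variable {e w : ℕ}

/-- Multi-headed attention `W_O · concat_j A_j(X)`. -/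
def mha {l : ℕ} (B : Block e w) (X : Matrix (Fin e) (Fin l) ℝ) : Matrix (Fin e) (Fin l) ℝ :=
  B.WO * Matrix.of fun (p : Fin B.heads × Fin e) (t : Fin l) => (B.head p.1).attn X p.2 t

/-- `B(X) = FFN(MHA(X) + X) + MHA(X) + X`. -/
def eval {l : ℕ} (B : Block e w) (X : Matrix (Fin e) (Fin l) ℝ) : Matrix (Fin e) (Fin l) ℝ :=
  B.ffn.apply (B.mha X + X) + B.mha X + X

def Bounded (B : Block e w) (κ : ℝ) : Prop :=
  (∀ j, (B.head j).Bounded κ) ∧ (∀ i p, |B.WO i p| ≤ κ) ∧ B.ffn.Bounded κ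

end Block

/-- The fixed (not learnable) input stage: the linear embedding `E = E' ∘ U` and the positional
encoding `PE`. -/
structure InputStage (D e l : ℕ) where
  U : Matrix (Fin l) (Fin D) ℝ
  E' : Fin e → ℝ
  PE : Matrix (Fin e) (Fin l) ℝ

namespace InputStage

variable {D e l : ℕ}

/-- `PE + E(x)`: the `t`-th token is `PE_t + (U x)_t E'`. -/
def eval (S : InputStage D e l) (x : EuclideanSpace ℝ (Fin D)) : Matrix (Fin e) (Fin l) ℝ :=
  S.PE + Matrix.of fun i t => S.E' i * (S.U *ᵥ fun j => x j) t

def Bounded (S : InputStage D e l) (κ : ℝ) : Prop :=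
  (∀ i j, |S.U i j| ≤ κ) ∧ (∀ i, |S.E' i| ≤ κ) ∧ ∀ i t, |S.PE i t| ≤ κ

end InputStage

/-- The parameters of a transformer network class. -/
structure Params where
  /-- number of transformer blocks -/
  LT : ℕ
  /-- maximal depth of the feed-forward layers -/
  Lff : ℕ
  /-- width of the feed-forward layers -/
  wff : ℕ
  /-- number of tokens -/
  l : ℕ
  /-- token embedding dimension -/
  dembd : ℕ
  /-- maximal number of attention heads per block -/
  m : ℕ
  /-- bound on the output -/
  R : ℝ
  /-- bound on the weights -/
  κ : ℝ
  l_pos : 0 < l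
  dembd_pos : 0 < dembd

/-- The decoder outputs the first entry of the last token. -/
def Params.decode (P : Params) (X : Matrix (Fin P.dembd) (Fin P.l) ℝ) : ℝ :=
  X ⟨0, P.dembd_pos⟩ ⟨P.l - 1, Nat.sub_lt P.l_pos one_pos⟩

/-- `T = decode ∘ B_{L_T} ∘ ⋯ ∘ B_1 ∘ (PE + E)`; the head of the list is `B_1`. -/
def transformer {D : ℕ} (P : Params) (S : InputStage D P.dembd P.l)
    (Bs : List (Block P.dembd P.wff)) (x : EuclideanSpace ℝ (Fin D)) : ℝ :=
  P.decode (Bs.foldl (fun X B => B.eval X) (S.eval x))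

/-- The transformer network class with parameters `P` and the fixed input stage `S`.
The networks are continuous, so the pointwise bound by `R` is the bound in `L^∞(ℝ^D)`. The entries
of the fixed input stage obey the weight bound too. -/
def transformerClass {D : ℕ} (P : Params) (S : InputStage D P.dembd P.l) :
    Set (EuclideanSpace ℝ (Fin D) → ℝ) :=
  {T | ∃ Bs : List (Block P.dembd P.wff),
      Bs.length = P.LT ∧
      (∀ B ∈ Bs, B.heads ≤ P.m ∧ B.ffn.depth ≤ P.Lff ∧ B.Bounded P.κ) ∧
      S.Bounded P.κ ∧
      T = transformer P S Bs ∧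
      ∀ x, |T x| ≤ P.R}

/-! ### Manifolds in Euclidean space and Hölder functions on them -/

variable {D : ℕ}

/-- `𝓜` is a smooth `d`-dimensional embedded submanifold (without boundary) of `ℝ^D`: around each of
its points, a smooth diffeomorphism between open subsets of `ℝ^D` carries `𝓜` to a `d`-dimensional
linear subspace. Its Riemannian metric is the induced one. -/
def IsSmoothSubmanifold (d : ℕ) (𝓜 : Set (EuclideanSpace ℝ (Fin D))) : Prop :=
  ∀ p ∈ 𝓜, ∃ (φ : OpenPartialHomeomorph (EuclideanSpace ℝ (Fin D)) (EuclideanSpace ℝ (Fin D)))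
    (L : Submodule ℝ (EuclideanSpace ℝ (Fin D))),
    p ∈ φ.source ∧ Module.finrank ℝ L = d ∧
    ContDiffOn ℝ ∞ φ φ.source ∧ ContDiffOn ℝ ∞ φ.symm φ.target ∧
    φ.IsImage 𝓜 (L : Set (EuclideanSpace ℝ (Fin D)))

/-- The reach: the infimum of all `r` for which some point `v` at distance `r` from `𝓜` has two
distinct nearest points in `𝓜` (`∞` if there is none). -/
def reach (𝓜 : Set (EuclideanSpace ℝ (Fin D))) : ℝ≥0∞ :=
  sInf {r | ∃ x ∈ 𝓜, ∃ y ∈ 𝓜, x ≠ y ∧ ∃ v : EuclideanSpace ℝ (Fin D),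
    r = edist x v ∧ edist x v = edist y v ∧ edist y v = Metric.infEDist v 𝓜}

/-- `𝓜` is covered by `N` charts: it lies in `N` open balls, centred on `𝓜`, of one radius
`r ≤ τ / 4`. -/
def HasChartCover (τ : ℝ) (N : ℕ) (𝓜 : Set (EuclideanSpace ℝ (Fin D))) : Prop :=
  ∃ r : ℝ, 0 < r ∧ r ≤ τ / 4 ∧ ∃ c : Fin N → EuclideanSpace ℝ (Fin D),
    (∀ n, c n ∈ 𝓜) ∧ 𝓜 ⊆ ⋃ n, Metric.ball (c n) r

/-- The intrinsic (geodesic) distance of `𝓜`: the infimum of the lengths of the curves in `𝓜` from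
`x` to `y`, which is `∞` if `x` and `y` lie in different components. -/
def geodesicEDist {𝓜 : Set (EuclideanSpace ℝ (Fin D))} (x y : 𝓜) : ℝ≥0∞ :=
  ⨅ γ : Path x y, eVariationOn (fun t => (γ t : EuclideanSpace ℝ (Fin D))) Set.univ

/-- `f` is `β`-Hölder on `𝓜` with constant `H`, for the intrinsic distance. As the intrinsic
distance is at least the Euclidean one, this includes the functions that are `β`-Hölder with
constant `H` for the Euclidean distance. -/
def IsHolder (H β : ℝ) {𝓜 : Set (EuclideanSpace ℝ (Fin D))} (f : 𝓜 → ℝ) : Prop :=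
  ∀ x y : 𝓜, edist (f x) (f y) ≤ ENNReal.ofReal H * geodesicEDist x y ^ β

end TransformerApprox

end

/-! Take a lattice of spacing `δ = c * ε ^ (1 / β)` in `ℝ^D` and interpolate `f` by the nodal
functions of the Kuhn triangulation, using only the nodes whose cells are met by `𝓜` after a
diagonal shift. These nodal functions are nonnegative with sum at most `1` everywhere and exactly
`1` on `𝓜`, and a node that is active at `x` carries the value of `f` at a point of `𝓜` at distance
`O(δ)` from `x`. So the error is a local oscillation of `f` (`abs_sum_kuhnHat_sub_le`), and the
interpolant is bounded by `R` on all of `ℝ^D` without clipping.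

The interpolant is computed exactly by two blocks (`readoutBlock_eval`). Each node has its own
token, with minus the lattice point in the positional encoding. The first attention layer adds `x /
δ` to every token, and the feed-forward layer turns the difference into the nodal value `relu (1 -
max of coordinate differences)`; the second attention layer forms the linear combination. ReLU
attention selects single tokens exactly, since `relu (1 - (s - t) ^ 2)` is an indicator at integers.

The geometry enters twice, through constants that depend on `𝓜` only by `τ` and the number of
charts: there are `O(δ ^ (-d))` nodes (`RegularTangents.smallCover`), and close points of `𝓜` have
geodesic distance at most twice the Euclidean one (`RegularTangents.geodesicEDist_le`). Both follow
from the fact that orthogonal projection to a tangent space is, within distance `τ / 200` of the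
base point, injective with 2-Lipschitz inverse (`RegularTangents.norm_le_two_mul_proj`), and that
its image contains a ball of radius `τ / 200` (`RegularTangents.exists_lift`). The source of these
is the empty tangent ball of radius `τ` (`UniqueNearest.inner_le`): it gives approximate midpoints
in `𝓜`, and iterated halving shows that secants deviate quadratically from the tangent space.
Smoothness is used only through the three properties in `RegularTangents`. -/

/-! ### Nearest points in sets of positive reach -/

section Reach

open Metric Filter Topology RealInnerProductSpace

variable {E : Type*} [NormedAddCommGroup E] [InnerProductSpace ℝ E]

namespace TransformerApprox

/-- Every point at distance less than `τ` from `K` has at most one nearest point in `K`. -/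
def UniqueNearest (τ : ℝ) (K : Set E) : Prop :=
  ∀ v, infDist v K < τ → ∀ p ∈ K, ∀ q ∈ K, dist v p = infDist v K → dist v q = infDist v K → p = q

/-- Moving `w` straight away from its nearest point raises the distance to `K` at a rate close to
`1`: as that nearest point is unique, the nearest points of the moved point stay near it, and the
direction of motion points almost straight away from them too. -/
theorem UniqueNearest.exists_infDist_lower {τ : ℝ} {K : Set E} (hK : IsCompact K)
    (hu : UniqueNearest τ K) {w p : E} (hp : p ∈ K) (hwp : dist w p = infDist w K)
    (h0 : 0 < infDist w K) (h1 : infDist w K < τ) {δ : ℝ} (hδ : 0 < δ) (hδ1 : δ < 1) :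
    ∃ h₀ > 0, ∀ h, 0 < h → h < h₀ →
      infDist w K + (1 - δ) * h ≤ infDist (w + (h / infDist w K) • (w - p)) K := by
  set ρ := infDist w K with hρ
  have hne : K.Nonempty := ⟨p, hp⟩
  -- Compactness turns uniqueness into a gap: points of `K` away from `p` are farther from `w` than
  -- `ρ` by a fixed `g`. A motion by less than `g / 2` cannot make them nearest.
  obtain ⟨g, hg, hgap⟩ : ∃ g > 0, ∀ q ∈ K, ρ * δ ≤ dist q p → ρ + g ≤ dist w q := by
    have hc : IsCompact (K ∩ {q | ρ * δ ≤ dist q p}) :=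
      hK.inter_right (isClosed_le continuous_const (by fun_prop))
    by_cases hn : (K ∩ {q | ρ * δ ≤ dist q p}).Nonempty
    · obtain ⟨q, ⟨hq, hqp⟩, hmin⟩ := hc.exists_isMinOn hn
        (f := fun q => dist w q) (by fun_prop)
      refine ⟨dist w q - ρ, ?_, fun q' hq' hd => ?_⟩
      · have h2 : ρ ≤ dist w q := infDist_le_dist_of_mem hq
        rcases h2.lt_or_eq with h3 | h3
        · linarith
        · have := hu w h1 p hp q hq hwp h3.symm
          subst this
          simp only [Set.mem_ofPred_eq, dist_self] at hqp
          nlinarith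
      · have := hmin ⟨hq', hd⟩
        simp only [Set.mem_ofPred_eq] at this
        linarith
    · refine ⟨1, one_pos, fun q hq hd => absurd ⟨q, hq, hd⟩ hn⟩
  refine ⟨g / 2, by positivity, fun h hh hhg => ?_⟩
  set u : E := (1 / ρ) • (w - p) with hu'
  have hun : ‖u‖ = 1 := by
    rw [hu', norm_smul, ← dist_eq_norm, hwp, Real.norm_of_nonneg (by positivity)]
    field_simp
  have hw : w + (h / ρ) • (w - p) = w + h • u := by
    rw [hu', smul_smul]; congr 2; ring
  rw [hw]
  obtain ⟨q, hq, hqd⟩ := hK.exists_infDist_eq_dist hne (w + h • u)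
  have hup : ⟪u, w - p⟫ = ρ := by
    rw [hu', real_inner_smul_left, real_inner_self_eq_norm_sq, ← dist_eq_norm, hwp]
    field_simp
  have hqp : dist q p < ρ * δ := by
    by_contra hcon
    push Not at hcon
    have h2 := hgap q hq hcon
    have h3 : dist (w + h • u) q ≤ ρ + h := by
      rw [← hqd]
      refine (infDist_le_dist_of_mem hp).trans ?_
      calc dist (w + h • u) p ≤ dist (w + h • u) w + dist w p := dist_triangle _ _ _
        _ = ρ + h := by
          rw [hwp, dist_eq_norm, add_sub_cancel_left, norm_smul, hun,
            Real.norm_of_nonneg hh.le]; ring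
    have h4 : dist w q ≤ h + dist (w + h • u) q := by
      calc dist w q ≤ dist w (w + h • u) + dist (w + h • u) q := dist_triangle _ _ _
        _ = _ := by
          rw [dist_comm w, dist_eq_norm, add_sub_cancel_left, norm_smul, hun,
            Real.norm_of_nonneg hh.le]; ring
    linarith
  have hin : ρ - ρ * δ ≤ ⟪u, w - q⟫ := by
    have h5 : ⟪u, w - q⟫ = ⟪u, w - p⟫ - ⟪u, q - p⟫ := by
      rw [← inner_sub_right]; congr 1; abel
    have h6 : ⟪u, q - p⟫ ≤ ‖u‖ * ‖q - p‖ := real_inner_le_norm _ _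
    rw [hun, one_mul, ← dist_eq_norm] at h6
    rw [h5, hup]; linarith
  have hwq : ρ ≤ ‖w - q‖ := by rw [← dist_eq_norm]; exact infDist_le_dist_of_mem hq
  rw [hqd, dist_eq_norm]
  refine le_of_sq_le_sq ?_ (norm_nonneg _)
  have h7 : ‖w + h • u - q‖ ^ 2 = ‖w - q‖ ^ 2 + 2 * h * ⟪u, w - q⟫ + h ^ 2 := by
    rw [show w + h • u - q = (w - q) + h • u by abel, norm_add_sq_real, norm_smul, hun,
      real_inner_smul_right, real_inner_comm, Real.norm_of_nonneg hh.le]; ring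
  rw [h7]
  have h8 : ρ ^ 2 ≤ ‖w - q‖ ^ 2 := by gcongr
  have h9 : (1 - δ) ^ 2 * h ^ 2 ≤ 1 * h ^ 2 := by
    gcongr
    exact pow_le_one₀ (by linarith) (by linarith)
  nlinarith [mul_le_mul_of_nonneg_left hin hh.le]

variable [FiniteDimensional ℝ E]

/-- A substitute for following the gradient flow of the distance function. For small `δ`, a
maximiser over the ball of `infDist w K - (1 - δ) * dist w v` cannot be interior, as
`exists_infDist_lower` with `δ / 2` would improve it. On the sphere it gains `(1 - δ) * s`, and a
maximiser of `infDist` serves for all `δ` at once. -/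
theorem UniqueNearest.exists_extension {τ : ℝ} {K : Set E} (hK : IsCompact K)
    (hu : UniqueNearest τ K) {v p : E} (hp : p ∈ K)
    (h0 : 0 < infDist v K) {s : ℝ} (hs : 0 < s) (hs1 : infDist v K + s < τ) :
    ∃ w ∈ closedBall v s, infDist v K + s ≤ infDist w K := by
  have hcb : IsCompact (closedBall v s) := isCompact_closedBall v s
  have hne : (closedBall v s).Nonempty := ⟨v, by simp [hs.le]⟩
  obtain ⟨w, hw, hmax⟩ := hcb.exists_isMaxOn hne (f := fun w => infDist w K)
    (continuous_infDist_pt K).continuousOn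
  refine ⟨w, hw, le_of_forall_pos_le_add fun η hη => ?_⟩
  obtain ⟨δ, hδ, hδ1, hδη⟩ : ∃ δ : ℝ, 0 < δ ∧ δ < 1 ∧ δ * s ≤ η := by
    refine ⟨min (1 / 2) (η / s), by positivity, by
      exact (min_le_left _ _).trans_lt (by norm_num), ?_⟩
    calc min (1 / 2) (η / s) * s ≤ η / s * s := by gcongr; exact min_le_right _ _
      _ = η := by field_simp
  obtain ⟨z, hz, hzmax⟩ := hcb.exists_isMaxOn hne
    (f := fun w => infDist w K - (1 - δ) * dist w v)
    ((continuous_infDist_pt K).sub (by fun_prop)).continuousOn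
  have hzv : infDist v K ≤ infDist z K - (1 - δ) * dist z v := by
    have := hzmax (show v ∈ closedBall v s by simp [hs.le])
    simpa using this
  have hzs : dist z v = s := by
    by_contra hcon
    have hlt : dist z v < s := lt_of_le_of_ne hz hcon
    have hz0 : 0 < infDist z K := by
      have : 0 ≤ (1 - δ) * dist z v := mul_nonneg (by linarith) dist_nonneg
      linarith
    have hz1 : infDist z K < τ := by
      have := infDist_le_infDist_add_dist (s := K) (x := z) (y := v)
      linarith
    obtain ⟨q, hq, hqd⟩ := hK.exists_infDist_eq_dist ⟨p, hp⟩ z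
    obtain ⟨h₀, hh₀, hstep⟩ := hu.exists_infDist_lower hK hq hqd.symm hz0 hz1
      (δ := δ / 2) (by linarith) (by linarith)
    obtain ⟨h, hh, hh1⟩ := exists_between (lt_min hh₀ (sub_pos.2 hlt))
    have hst := hstep h hh (hh1.trans_le (min_le_left _ _))
    set z' := z + (h / infDist z K) • (z - q)
    have hzz : dist z' z = h := by
      rw [dist_eq_norm, add_sub_cancel_left, norm_smul, ← dist_eq_norm, ← hqd,
        Real.norm_of_nonneg (by positivity)]
      field_simp
    have hz'v : dist z' v ≤ h + dist z v := by
      rw [← hzz]; exact dist_triangle _ _ _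
    have hmem : z' ∈ closedBall v s := by
      rw [mem_closedBall]
      have := hh1.trans_le (min_le_right _ _)
      linarith
    have h1 := hzmax hmem
    simp only [Set.mem_ofPred_eq] at h1
    nlinarith [mul_le_mul_of_nonneg_left hz'v (by linarith : (0:ℝ) ≤ 1 - δ), mul_pos hδ hh]
  have h2 := hmax hz
  simp only [Set.mem_ofPred_eq] at h2
  rw [hzs] at hzv
  linarith

/-- The ball of radius `τ` touching `K` at `p` in a normal direction has no point of `K` inside. -/
theorem UniqueNearest.inner_le {τ : ℝ} {K : Set E} (hK : IsCompact K)
    (hu : UniqueNearest τ K) {v p q : E} (hp : p ∈ K) (hq : q ∈ K)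
    (hvp : dist v p = infDist v K) (h1 : infDist v K < τ) :
    2 * τ * ⟪v - p, q - p⟫ ≤ ‖v - p‖ * ‖q - p‖ ^ 2 := by
  rcases (infDist_nonneg (x := v) (s := K)).eq_or_lt with h0 | h0
  · rw [← h0, dist_eq_norm] at hvp
    rw [norm_eq_zero.1 hvp]; simp
  set t := infDist v K with ht
  have hvp' : ‖v - p‖ = t := by rw [← dist_eq_norm, hvp]
  rcases le_or_gt ⟪v - p, q - p⟫ 0 with hi | hi
  · have hτ : 0 < τ := h0.trans h1
    have : 2 * τ * ⟪v - p, q - p⟫ ≤ 0 := mul_nonpos_of_nonneg_of_nonpos (by positivity) hi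
    exact this.trans (by positivity)
  -- The extended point `w` is within `s` of `v` and at least `t + s` from `p`. This is equality in
  -- the triangle inequality, so `w` lies on the ray from `p` through `v`. Expanding `t + s ≤ ‖w -
  -- q‖` gives the claim with `t + s` for `τ`; afterwards `t + s` tends to `τ`.
  have key : ∀ s, 0 < s → t + s < τ → 2 * (t + s) * ⟪v - p, q - p⟫ ≤ t * ‖q - p‖ ^ 2 := by
    intro s hs hs1
    obtain ⟨w, hw, hwd⟩ := hu.exists_extension hK hp h0 hs hs1
    rw [mem_closedBall, dist_eq_norm] at hw
    have hwp : t + s ≤ ‖w - p‖ := by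
      rw [← dist_eq_norm]; exact hwd.trans (infDist_le_dist_of_mem hp)
    have hin : s * t ≤ ⟪w - v, v - p⟫ := by
      have h3 : ‖w - p‖ ^ 2 = ‖w - v‖ ^ 2 + 2 * ⟪w - v, v - p⟫ + ‖v - p‖ ^ 2 := by
        rw [← norm_add_sq_real]; congr 2; abel
      have h4 : (t + s) ^ 2 ≤ ‖w - p‖ ^ 2 := by gcongr
      have h5 : ‖w - v‖ ^ 2 ≤ s ^ 2 := by gcongr
      rw [hvp'] at h3
      nlinarith
    have hw2 : w - v = (s / t) • (v - p) := by
      rw [← sub_eq_zero, ← norm_eq_zero, ← sq_eq_zero_iff]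
      refine le_antisymm ?_ (sq_nonneg _)
      rw [norm_sub_sq_real, real_inner_smul_right, norm_smul, hvp', Real.norm_of_nonneg
        (by positivity)]
      have h5 : ‖w - v‖ ^ 2 ≤ s ^ 2 := by gcongr
      have h6 : s / t * (s * t) ≤ s / t * ⟪w - v, v - p⟫ := by gcongr
      have h7 : s / t * (s * t) = s ^ 2 := by field_simp
      have h8 : s / t * t = s := by field_simp
      rw [h8]; linarith
    have hwq : t + s ≤ ‖w - q‖ := by
      rw [← dist_eq_norm]; exact hwd.trans (infDist_le_dist_of_mem hq)
    have hwq2 : w - q = ((t + s) / t) • (v - p) - (q - p) := by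
      have : w - q = (w - v) + (v - p) - (q - p) := by abel
      rw [this, hw2, show (t + s) / t = s / t + 1 by field_simp; ring, add_smul, one_smul]
    have h9 : (t + s) ^ 2 ≤ ‖w - q‖ ^ 2 := by gcongr
    rw [hwq2, norm_sub_sq_real, real_inner_smul_left, norm_smul, hvp', Real.norm_of_nonneg
        (by positivity), show (t + s) / t * t = t + s by field_simp] at h9
    have h10 : 2 * ((t + s) / t * ⟪v - p, q - p⟫) ≤ ‖q - p‖ ^ 2 := by linarith
    calc 2 * (t + s) * ⟪v - p, q - p⟫ = t * (2 * ((t + s) / t * ⟪v - p, q - p⟫)) := by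
          field_simp
      _ ≤ _ := by gcongr
  rw [hvp']
  refine le_of_forall_pos_sub_le fun η hη => ?_
  obtain ⟨s, hs⟩ := exists_between (show max t (τ - η / (2 * ⟪v - p, q - p⟫)) < τ from
    max_lt h1 (by have : 0 < η / (2 * ⟪v - p, q - p⟫) := by positivity
                  linarith))
  have h3 := key (s - t) (by linarith [(le_max_left _ _).trans_lt hs.1]) (by linarith [hs.2])
  have h4 : τ - s < η / (2 * ⟪v - p, q - p⟫) := by linarith [(le_max_right _ _).trans_lt hs.1]
  rw [lt_div_iff₀ (by positivity)] at h4
  have h5 : t + (s - t) = s := by ring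
  rw [h5] at h3
  linarith

/-- Near the midpoint of two points of `K` there is a point of `K`. -/
theorem UniqueNearest.exists_near_midpoint {τ : ℝ} {K : Set E} (hK : IsCompact K)
    (hu : UniqueNearest τ K) {x y : E} (hx : x ∈ K) (hy : y ∈ K) (hxy : ‖y - x‖ < 2 * τ) :
    ∃ m ∈ K, ‖m - x - (1 / 2 : ℝ) • (y - x)‖ ≤ ‖y - x‖ ^ 2 / (4 * τ) := by
  set v : E := x + (1 / 2 : ℝ) • (y - x) with hv
  obtain ⟨p, hp, hpd⟩ := hK.exists_infDist_eq_dist ⟨x, hx⟩ v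
  refine ⟨p, hp, ?_⟩
  have hτ : 0 < τ := by linarith [norm_nonneg (y - x)]
  have hvx : v - x = (1 / 2 : ℝ) • (y - x) := by rw [hv]; abel
  have hvy : v - y = -((1 / 2 : ℝ) • (y - x)) := by rw [hv]; module
  have hpx : p - x - (1 / 2 : ℝ) • (y - x) = -(v - p) := by rw [hv]; abel
  rw [hpx, norm_neg]
  set a := ‖y - x‖ / 2 with ha
  have ha0 : 0 ≤ a := by positivity
  have hba : ‖v - p‖ ≤ a := by
    rw [← dist_eq_norm, ← hpd]
    refine (infDist_le_dist_of_mem hx).trans ?_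
    rw [dist_eq_norm, hvx, norm_smul, Real.norm_of_nonneg (by norm_num)]; linarith
  have hlt : infDist v K < τ := by
    rw [hpd, dist_eq_norm]; linarith
  have h1 := hu.inner_le hK hp hx hpd.symm hlt
  -- The sum of `h1` and `h2` has no term linear in `y - x`, which leaves `4 * τ * b ≤ 2 * (a ^ 2 +
  -- b ^ 2)` for the distance `b` from the midpoint to `K`. With `b ≤ a` this is `b ≤ a ^ 2 / τ`.
  have h2 := hu.inner_le hK hp hy hpd.symm hlt
  have hx1 : x - p = (v - p) - (1 / 2 : ℝ) • (y - x) := by rw [← hvx]; abel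
  have hy1 : y - p = (v - p) + (1 / 2 : ℝ) • (y - x) := by rw [← neg_neg ((1 / 2 : ℝ) • (y - x)), ← hvy]; abel
  generalize v - p = z at *
  set b := ‖z‖ with hb
  have hb0 : 0 ≤ b := norm_nonneg _
  have hn : ‖(1 / 2 : ℝ) • (y - x)‖ = a := by
    rw [norm_smul, Real.norm_of_nonneg (by norm_num)]; ring
  rw [hx1, inner_sub_right, real_inner_self_eq_norm_sq, norm_sub_sq_real, hn, ← hb] at h1
  rw [hy1, inner_add_right, real_inner_self_eq_norm_sq, norm_add_sq_real, hn, ← hb] at h2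
  rw [le_div_iff₀ (by positivity)]
  rcases hb0.eq_or_lt with hb00 | hb00
  · rw [← hb00]; simp
  have h3 : b * (4 * τ * b) ≤ b * (2 * (a ^ 2 + b ^ 2)) := by nlinarith
  have h4 := le_of_mul_le_mul_left h3 hb00
  have : ‖y - x‖ = 2 * a := by rw [ha]; ring
  rw [this]
  nlinarith

end TransformerApprox

end Reach

/-! ### Tangent spaces of sets of positive reach -/

section Tangent

open Metric Filter Topology RealInnerProductSpace

variable {E : Type*} [NormedAddCommGroup E] [InnerProductSpace ℝ E] [FiniteDimensional ℝ E]

namespace TransformerApprox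

/-- The properties of the tangent spaces of a submanifold without boundary that are used below. -/
structure RegularTangents (K : Set E) (T : E → Submodule ℝ E) : Prop where
  velocity : ∀ z ∈ K, ∀ v ∈ T z, ∃ γ : ℝ → E, γ 0 = z ∧ HasDerivAt γ v 0 ∧ ∀ᶠ h in 𝓝 0, γ h ∈ K
  secant : ∀ z ∈ K, ∀ (m : ℕ → E) (v : E), (∀ᶠ n in atTop, m n ∈ K) → Tendsto m atTop (𝓝 z) →
    ∀ c : ℕ → ℝ, Tendsto (fun n => c n • (m n - z)) atTop (𝓝 v) → v ∈ T z
  transversal : ∀ x ∈ K, ∀ᶠ z in 𝓝[K] x, ∀ e ∈ T x, (∀ w ∈ T z, ⟪e, w⟫ = 0) → e = 0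

theorem norm_sub_starProjection_le (T : Submodule ℝ E) (w : E) :
    ‖w - T.starProjection w‖ ≤ ‖w‖ := by
  have h := Tᗮ.norm_starProjection_apply_le w
  rwa [Submodule.starProjection_orthogonal_val] at h

variable {τ : ℝ} {K : Set E} {T : E → Submodule ℝ E}

/-- Replacing `y` again and again by a near-midpoint of `x` and `y` produces points `m n` of `K`
tending to `x`. The rescaled secants `2 ^ n • (m n - x)` change by a geometric series of size `‖y -
x‖ ^ 2 / τ`, and their limit is tangent. -/
theorem RegularTangents.exists_tangent_near (hT : RegularTangents K T) (hK : IsCompact K)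
    (hu : UniqueNearest τ K) (hτ : 0 < τ) {x y : E} (hx : x ∈ K) (hy : y ∈ K)
    (hxy : ‖y - x‖ ≤ τ / 2) : ∃ v ∈ T x, ‖y - x - v‖ ≤ 3 * ‖y - x‖ ^ 2 / τ := by
  have step : ∀ y, ∃ m, y ∈ K → ‖y - x‖ < 2 * τ →
      m ∈ K ∧ ‖m - x - (1 / 2 : ℝ) • (y - x)‖ ≤ ‖y - x‖ ^ 2 / (4 * τ) := by
    intro y
    by_cases h : y ∈ K ∧ ‖y - x‖ < 2 * τ
    · obtain ⟨m, hm, hmm⟩ := hu.exists_near_midpoint hK hx h.1 h.2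
      exact ⟨m, fun _ _ => ⟨hm, hmm⟩⟩
    · exact ⟨0, fun h1 h2 => absurd ⟨h1, h2⟩ h⟩
  choose f hf using step
  set r := ‖y - x‖ with hr
  have hr0 : 0 ≤ r := norm_nonneg _
  set m : ℕ → E := fun n => f^[n] y with hm
  have hms : ∀ n, m (n + 1) = f (m n) := fun n => Function.iterate_succ_apply' f n y
  -- The ratio `5 / 8` is `1 / 2 + 1 / 8`: within distance `τ / 2` the midpoint error is at most an
  -- eighth of the distance.
  have main : ∀ n, m n ∈ K ∧ ‖m n - x‖ ≤ (5 / 8) ^ n * r := by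
    intro n
    induction n with
    | zero => exact ⟨hy, by simp [hm, hr]⟩
    | succ n ih =>
      have hle : ‖m n - x‖ ≤ r := ih.2.trans
        (mul_le_of_le_one_left hr0 (pow_le_one₀ (by norm_num) (by norm_num)))
      obtain ⟨h1, h2⟩ := hf (m n) ih.1 (by linarith)
      rw [hms]
      refine ⟨h1, ?_⟩
      have h3 : ‖f (m n) - x‖ ≤ ‖m n - x‖ ^ 2 / (4 * τ) + 1 / 2 * ‖m n - x‖ := by
        calc ‖f (m n) - x‖ = ‖(f (m n) - x - (1 / 2 : ℝ) • (m n - x))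
              + (1 / 2 : ℝ) • (m n - x)‖ := by congr 1; abel
          _ ≤ _ := (norm_add_le _ _).trans (by
              rw [norm_smul, Real.norm_of_nonneg (by norm_num : (0:ℝ) ≤ 1 / 2)]; gcongr)
      have h4 : ‖m n - x‖ ^ 2 / (4 * τ) ≤ 1 / 8 * ‖m n - x‖ := by
        rw [div_le_iff₀ (by positivity)]
        nlinarith [norm_nonneg (m n - x)]
      rw [pow_succ]
      linarith [ih.2]
  set v : ℕ → E := fun n => (2 : ℝ) ^ n • (m n - x) with hv
  -- The ratio is `25 / 32 = 2 * (5 / 8) ^ 2`, as the error is quadratic in the distance and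
  -- rescaled by a factor `2`. The series sums to `16 / 7 * r ^ 2 / τ`, below the claimed `3 * r ^ 2
  -- / τ`.
  have hcau : ∀ n, dist (v n) (v (n + 1)) ≤ r ^ 2 / (2 * τ) * (25 / 32) ^ n := by
    intro n
    have hle : ‖m n - x‖ ≤ r := (main n).2.trans
      (mul_le_of_le_one_left hr0 (pow_le_one₀ (by norm_num) (by norm_num)))
    obtain ⟨h1, h2⟩ := hf (m n) (main n).1 (by linarith)
    rw [dist_comm, dist_eq_norm]
    have h3 : v (n + 1) - v n = (2 : ℝ) ^ (n + 1) • (f (m n) - x - (1 / 2 : ℝ) • (m n - x)) := by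
      simp only [hv, hms, pow_succ]
      module
    rw [h3, norm_smul, Real.norm_of_nonneg (by positivity)]
    calc (2 : ℝ) ^ (n + 1) * ‖f (m n) - x - (1 / 2 : ℝ) • (m n - x)‖
        ≤ 2 ^ (n + 1) * (((5 / 8) ^ n * r) ^ 2 / (4 * τ)) := by
          gcongr
          exact h2.trans (by gcongr; exact (main n).2)
      _ = _ := by
          rw [show (25 / 32 : ℝ) = 2 * (5 / 8) ^ 2 by norm_num, mul_pow, mul_pow, ← pow_mul,
            ← pow_mul, mul_comm 2 n, pow_succ]
          field_simp
          ring
  obtain ⟨w, hw⟩ := cauchySeq_tendsto_of_complete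
    (cauchySeq_of_le_geometric (25 / 32) _ (by norm_num) hcau)
  have hd := dist_le_of_le_geometric_of_tendsto₀ (25 / 32) _ (by norm_num) hcau hw
  refine ⟨w, hT.secant x hx m w (Eventually.of_forall fun n => (main n).1) ?_ _ hw, ?_⟩
  · rw [tendsto_iff_norm_sub_tendsto_zero]
    refine squeeze_zero (fun n => norm_nonneg _) (fun n => (main n).2) ?_
    have := (tendsto_pow_atTop_nhds_zero_of_lt_one (by norm_num : (0:ℝ) ≤ 5 / 8)
      (by norm_num)).mul_const r
    simpa using this
  · have h0 : v 0 = y - x := by simp [hv, hm]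
    rw [h0, dist_eq_norm] at hd
    refine hd.trans ?_
    rw [div_le_div_iff₀ (by norm_num) (by positivity)]
    have : r ^ 2 / (2 * τ) * τ = r ^ 2 / 2 := by field_simp
    rw [this]
    nlinarith [sq_nonneg r]

theorem RegularTangents.norm_sub_proj_le (hT : RegularTangents K T) (hK : IsCompact K)
    (hu : UniqueNearest τ K) (hτ : 0 < τ) {x y : E} (hx : x ∈ K) (hy : y ∈ K)
    (hxy : ‖y - x‖ ≤ τ / 2) :
    ‖(y - x) - (T x).starProjection (y - x)‖ ≤ 3 * ‖y - x‖ ^ 2 / τ := by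
  obtain ⟨v, hv, hvd⟩ := hT.exists_tangent_near hK hu hτ hx hy hxy
  have h1 : (y - x) - (T x).starProjection (y - x) =
      (y - x - v) - (T x).starProjection (y - x - v) := by
    rw [map_sub _ (y - x) v, Submodule.starProjection_eq_self_iff.2 hv]; abel
  rw [h1]
  exact (norm_sub_starProjection_le _ _).trans hvd

theorem RegularTangents.abs_inner_le (hT : RegularTangents K T) (hK : IsCompact K)
    (hu : UniqueNearest τ K) (hτ : 0 < τ) {x y e : E} (hx : x ∈ K) (hy : y ∈ K)
    (hxy : ‖y - x‖ ≤ τ / 2) (he : ∀ w ∈ T x, ⟪e, w⟫ = 0) :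
    |⟪e, y - x⟫| ≤ ‖e‖ * (3 * ‖y - x‖ ^ 2 / τ) := by
  obtain ⟨v, hv, hvd⟩ := hT.exists_tangent_near hK hu hτ hx hy hxy
  have h1 : ⟪e, y - x⟫ = ⟪e, y - x - v⟫ := by rw [inner_sub_right _ _ v, he v hv, sub_zero]
  rw [h1]
  exact (abs_real_inner_le_norm _ _).trans (by gcongr)

/-- A point of `K` is found above each small tangent vector. -/
theorem RegularTangents.exists_lift (hT : RegularTangents K T) (hK : IsCompact K)
    (hu : UniqueNearest τ K) (hτ : 0 < τ) {x : E} (hx : x ∈ K) {v : E} (hv : v ∈ T x)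
    (hvn : ‖v‖ ≤ τ / 200) :
    ∃ z ∈ K, (T x).starProjection (z - x) = v ∧ ‖z - x‖ ≤ 2 * ‖v‖ := by
  set π := (T x).starProjection with hπ
  have hπc : Continuous π := π.continuous
  have hexp : ∀ z ∈ K, ‖z - x‖ ≤ 4 * (τ / 200) → ‖z - x‖ ≤ 2 * ‖π (z - x)‖ := by
    intro z hz hzx
    have h1 := hT.norm_sub_proj_le hK hu hτ hx hz (by linarith)
    have h2 : 3 * ‖z - x‖ ^ 2 / τ ≤ 1 / 2 * ‖z - x‖ := by
      rw [div_le_iff₀ hτ]; nlinarith [norm_nonneg (z - x)]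
    have h3 : ‖z - x‖ ≤ ‖(z - x) - π (z - x)‖ + ‖π (z - x)‖ := by
      calc ‖z - x‖ = ‖((z - x) - π (z - x)) + π (z - x)‖ := by congr 1; abel
        _ ≤ _ := norm_add_le _ _
    linarith
  set I : Set E := (fun z => π (z - x)) '' (K ∩ closedBall x (4 * (τ / 200))) with hI
  have hIc : IsCompact I := (hK.inter_right isClosed_closedBall).image (by fun_prop)
  suffices hmem : v ∈ I by
    obtain ⟨z, ⟨hz, hzx⟩, hzv⟩ := hmem
    rw [mem_closedBall, dist_eq_norm] at hzx
    refine ⟨z, hz, hzv, ?_⟩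
    have := hexp z hz hzx
    simp only at hzv
    rwa [hzv] at this
  by_contra hvI
  have h0I : (0 : E) ∈ I := ⟨x, ⟨hx, by simp; positivity⟩, by simp⟩
  -- `t` is the least norm at which the image `I` of the projection starts to miss tangent vectors.
  -- As `I` is closed, it contains the closed tangent ball of radius `t`.
  set S : Set ℝ := norm '' {w | w ∈ T x ∧ ‖w‖ ≤ τ / 200 ∧ w ∉ I} with hS
  have hSne : S.Nonempty := ⟨_, v, ⟨hv, hvn, hvI⟩, rfl⟩
  have hSb : BddBelow S := ⟨0, by rintro _ ⟨w, _, rfl⟩; exact norm_nonneg w⟩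
  set t := sInf S with ht
  have ht0 : 0 ≤ t := le_csInf hSne (by rintro _ ⟨w, _, rfl⟩; exact norm_nonneg w)
  have htle : t ≤ τ / 200 := (csInf_le hSb ⟨v, ⟨hv, hvn, hvI⟩, rfl⟩).trans hvn
  have hlt : ∀ w ∈ T x, ‖w‖ < t → w ∈ I := by
    intro w hw hwt
    by_contra hcon
    exact absurd (csInf_le hSb ⟨w, ⟨hw, by linarith, hcon⟩, rfl⟩) (not_le.2 hwt)
  have hle : ∀ w ∈ T x, ‖w‖ ≤ t → w ∈ I := by
    intro w hw hwt
    rcases hwt.lt_or_eq with h | h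
    · exact hlt w hw h
    rcases ht0.eq_or_lt with h' | h'
    · rw [← h', norm_eq_zero] at h; rwa [h]
    refine hIc.isClosed.mem_of_tendsto (b := 𝓝[<] (1 : ℝ)) (f := fun a : ℝ => a • w) ?_ ?_
    · have : Tendsto (fun a : ℝ => a • w) (𝓝 1) (𝓝 ((1 : ℝ) • w)) :=
        (continuous_id.smul continuous_const).tendsto _
      rw [one_smul] at this
      exact this.mono_left nhdsWithin_le_nhds
    · have : Set.Ioo (0 : ℝ) 1 ∈ 𝓝[<] (1 : ℝ) := Ioo_mem_nhdsLT one_pos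
      filter_upwards [this] with a ha
      refine hlt _ ((T x).smul_mem a hw) ?_
      rw [norm_smul, Real.norm_of_nonneg ha.1.le, h]
      exact mul_lt_of_lt_one_left h' ha.2
  -- a vector outside `I` close to the sphere of radius `t` has a nearest point in `I`, and the
  -- difference is normal to `K` at the corresponding point
  have hbad : ∀ g > 0, ∃ z ∈ K, ∃ e ∈ T x, e ≠ 0 ∧ ‖z - x‖ ≤ 2 * (t + g) ∧
      ∀ w ∈ T z, ⟪e, w⟫ = 0 := by
    intro g hg
    obtain ⟨g', hg', hg'1⟩ := exists_between (show (0 : ℝ) < min g (τ / 400) by positivity)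
    have hg1 := hg'1.trans_le (min_le_left _ _)
    have hg2 := hg'1.trans_le (min_le_right _ _)
    obtain ⟨_, ⟨w, ⟨hwT, hwn, hwI⟩, rfl⟩, hwt⟩ := exists_lt_of_csInf_lt hSne
      (show sInf S < t + g' / 2 by linarith)
    have htw : t ≤ ‖w‖ := csInf_le hSb ⟨w, ⟨hwT, hwn, hwI⟩, rfl⟩
    obtain ⟨_, ⟨z, ⟨hz, hzx⟩, rfl⟩, hmin⟩ := hIc.exists_isMinOn ⟨0, h0I⟩
      (f := fun q => dist w q) (by fun_prop)
    have hw0 : w ≠ 0 := fun h => hwI (h ▸ h0I)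
    have hw0' : 0 < ‖w‖ := norm_pos_iff.2 hw0
    -- The radial point of norm `t` below `w` lies in `I`, so the nearest point of `I` is within
    -- `‖w‖ - t`.
    have hd : dist w (π (z - x)) ≤ ‖w‖ - t := by
      have h1 : (t / ‖w‖) • w ∈ I := hle _ ((T x).smul_mem _ hwT) (by
        rw [norm_smul, Real.norm_of_nonneg (by positivity)]; field_simp; exact le_rfl)
      refine (hmin h1).trans ?_
      simp only
      rw [dist_eq_norm, show w - (t / ‖w‖) • w = (1 - t / ‖w‖) • w by module, norm_smul,
        Real.norm_of_nonneg (by rw [sub_nonneg, div_le_one hw0']; exact htw)]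
      apply le_of_eq; field_simp
    have hπn : ‖π (z - x)‖ ≤ t + g' := by
      have : ‖π (z - x)‖ ≤ ‖w‖ + dist w (π (z - x)) := by
        rw [dist_comm, dist_eq_norm]
        calc ‖π (z - x)‖ = ‖w + (π (z - x) - w)‖ := by congr 1; abel
          _ ≤ _ := norm_add_le _ _
      linarith
    rw [mem_closedBall, dist_eq_norm] at hzx
    have hzx2 := hexp z hz hzx
    -- Strictness keeps short curves in `K` through `z` inside the ball that defines `I`, so the
    -- minimality of `z` has a first-order condition along them.
    have hzx3 : ‖z - x‖ < 4 * (τ / 200) := by linarith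
    refine ⟨z, hz, w - π (z - x), (T x).sub_mem hwT (Submodule.starProjection_apply_mem _ _), ?_,
      by linarith, fun u hu => ?_⟩
    · intro h
      rw [sub_eq_zero] at h
      exact hwI ⟨z, ⟨hz, by rwa [mem_closedBall, dist_eq_norm]⟩, h.symm⟩
    · obtain ⟨γ, hγ0, hγd, hγK⟩ := hT.velocity z hz u hu
      have hder : HasDerivAt (fun h => ‖w - π (γ h - x)‖ ^ 2)
          (2 * ⟪w - π (z - x), -π u⟫) 0 := by
        have h1 : HasDerivAt (fun h => w - π (γ h - x)) (-π u) 0 := by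
          have := (π.hasFDerivAt.comp_hasDerivAt (0 : ℝ) (hγd.sub_const x)).const_sub w
          exact this
        have := h1.norm_sq
        rwa [hγ0] at this
      have hloc : IsLocalMin (fun h => ‖w - π (γ h - x)‖ ^ 2) 0 := by
        have hnear : ∀ᶠ h in 𝓝 (0 : ℝ), ‖γ h - x‖ < 4 * (τ / 200) := by
          have hc : ContinuousAt (fun h => ‖γ h - x‖) 0 :=
            (hγd.continuousAt.sub continuousAt_const).norm
          refine hc.eventually_lt continuousAt_const ?_
          rwa [hγ0]
        filter_upwards [hγK, hnear] with h h1 h2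
        have h3 := hmin (show π (γ h - x) ∈ I from
          ⟨γ h, ⟨h1, by rw [mem_closedBall, dist_eq_norm]; exact h2.le⟩, rfl⟩)
        simp only [Set.mem_ofPred_eq, dist_eq_norm] at h3
        rw [hγ0]
        gcongr
      have h0 := hloc.hasDerivAt_eq_zero hder
      have h4 : ⟪w - π (z - x), π u⟫ = ⟪w - π (z - x), u⟫ := by
        rw [hπ, ← Submodule.inner_starProjection_left_eq_right,
          Submodule.starProjection_eq_self_iff.2
            ((T x).sub_mem hwT (Submodule.starProjection_apply_mem _ _))]
      rw [inner_neg_right, h4] at h0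
      linarith
  -- If `t = 0`, the normals `e` occur at points `z` arbitrarily close to `x`, against
  -- transversality. If `t > 0`, the vector of length `t` along `e` lifts to some `y` in `K`. As `e`
  -- is normal at `z`, its products with `y - z` and `x - z` are quadratically small, yet their
  -- difference is `‖e‖ * t`; this gives `t ≤ 156 * t ^ 2 / τ`, impossible for `0 < t ≤ τ / 200`.
  rcases ht0.eq_or_lt with h' | h'
  · have htr := hT.transversal x hx
    rw [eventually_nhdsWithin_iff, Metric.eventually_nhds_iff] at htr
    obtain ⟨r, hr, htr⟩ := htr
    obtain ⟨z, hz, e, he, he0, hzx, hew⟩ := hbad (r / 4) (by positivity)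
    refine he0 (htr (y := z) ?_ hz e he hew)
    rw [dist_eq_norm]
    linarith
  · obtain ⟨z, hz, e, he, he0, hzx, hew⟩ := hbad t h'
    have hen : 0 < ‖e‖ := norm_pos_iff.2 he0
    obtain ⟨y, ⟨hy, hyx⟩, hye⟩ := hle ((t / ‖e‖) • e) ((T x).smul_mem _ he) (by
        rw [norm_smul, Real.norm_of_nonneg (by positivity)]; field_simp; exact le_rfl)
    rw [mem_closedBall, dist_eq_norm] at hyx
    have hyx2 := hexp y hy hyx
    simp only at hye
    have hyx3 : ‖y - x‖ ≤ 2 * t := by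
      rw [hye, norm_smul, Real.norm_of_nonneg (by positivity)] at hyx2
      field_simp at hyx2
      linarith
    have hyz : ‖y - z‖ ≤ 6 * t := by
      calc ‖y - z‖ = ‖(y - x) - (z - x)‖ := by congr 1; abel
        _ ≤ _ := norm_sub_le _ _
        _ ≤ _ := by linarith
    have hxz : ‖x - z‖ ≤ 4 * t := by rw [norm_sub_rev]; linarith
    have h1 := hT.abs_inner_le hK hu hτ hz hy (by linarith) hew
    have h2 := hT.abs_inner_le hK hu hτ hz hx (by linarith) hew
    have h3 : ⟪e, y - x⟫ = ‖e‖ * t := by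
      have : ⟪e, y - x⟫ = ⟪e, π (y - x)⟫ := by
        rw [hπ, ← Submodule.inner_starProjection_left_eq_right,
          Submodule.starProjection_eq_self_iff.2 he]
      rw [this, hye, real_inner_smul_right, real_inner_self_eq_norm_sq]
      field_simp
    have h4 : ⟪e, y - x⟫ = ⟪e, y - z⟫ - ⟪e, x - z⟫ := by rw [← inner_sub_right]; congr 1; abel
    have h5 : ‖e‖ * (3 * ‖y - z‖ ^ 2 / τ) ≤ ‖e‖ * (3 * (6 * t) ^ 2 / τ) := by gcongr
    have h6 : ‖e‖ * (3 * ‖x - z‖ ^ 2 / τ) ≤ ‖e‖ * (3 * (4 * t) ^ 2 / τ) := by gcongr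
    have h7 : ‖e‖ * t ≤ ‖e‖ * (156 * t ^ 2 / τ) := by
      have : ‖e‖ * (156 * t ^ 2 / τ) =
        ‖e‖ * (3 * (6 * t) ^ 2 / τ) + ‖e‖ * (3 * (4 * t) ^ 2 / τ) := by ring
      rw [this]
      linarith [(abs_le.1 h1).2, (abs_le.1 h2).1]
    have h8 := le_of_mul_le_mul_left h7 hen
    rw [le_div_iff₀ hτ] at h8
    nlinarith

/-- Tangent spaces at points close to each other make a small angle. -/
theorem RegularTangents.norm_tangent_sub_proj_le (hT : RegularTangents K T) (hK : IsCompact K)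
    (hu : UniqueNearest τ K) (hτ : 0 < τ) {x p : E} (hx : x ∈ K) (hp : p ∈ K)
    (hxp : ‖x - p‖ ≤ τ / 200) {v : E} (hv : v ∈ T x) :
    ‖v - (T p).starProjection v‖ ≤ 21 / 100 * ‖v‖ := by
  rcases eq_or_ne v 0 with rfl | hv0
  · simp
  have hvn : 0 < ‖v‖ := norm_pos_iff.2 hv0
  -- The angle is tested on the multiple of `v` of length `s`. It is the projection of a secant `y -
  -- x` of `K`, and `y - x`, `y - p`, `x - p` each deviate quadratically from the relevant tangent
  -- space. Their lengths are at most `2 * s`, `3 * s`, `s`, which gives `42 = 3 * (4 + 9 + 1)`.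
  set s := τ / 200 with hs
  have hs0 : 0 < s := by positivity
  have hτs : τ = 200 * s := by rw [hs]; ring
  set w := (s / ‖v‖) • v with hw
  have hwn : ‖w‖ = s := by
    rw [hw, norm_smul, Real.norm_of_nonneg (by positivity)]; field_simp
  obtain ⟨y, hy, hyw, hyn⟩ := hT.exists_lift hK hu hτ hx ((T x).smul_mem (s / ‖v‖) hv) hwn.le
  change (T x).starProjection (y - x) = w at hyw
  change ‖y - x‖ ≤ 2 * ‖w‖ at hyn
  rw [hwn] at hyn
  have hyp : ‖y - p‖ ≤ 3 * s := by
    calc ‖y - p‖ = ‖(y - x) + (x - p)‖ := by congr 1; abel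
      _ ≤ _ := norm_add_le _ _
      _ ≤ _ := by linarith
  have h1 := hT.norm_sub_proj_le hK hu hτ hx hy (by linarith)
  have h2 := hT.norm_sub_proj_le hK hu hτ hp hy (by linarith)
  have h3 := hT.norm_sub_proj_le hK hu hτ hp hx (by linarith)
  rw [hyw] at h1
  have h4 := norm_sub_starProjection_le (T p) ((y - x) - w)
  have h5 : w - (T p).starProjection w = ((y - p) - (T p).starProjection (y - p))
      - ((x - p) - (T p).starProjection (x - p))
      - (((y - x) - w) - (T p).starProjection ((y - x) - w)) := by
    simp only [map_sub]; abel
  have h6 : ‖w - (T p).starProjection w‖ ≤ 42 / 200 * s := by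
    rw [h5]
    refine (norm_sub_le _ _).trans ((add_le_add_left (norm_sub_le _ _) _).trans ?_)
    have e1 : 3 * ‖y - x‖ ^ 2 / τ ≤ 3 * (2 * s) ^ 2 / τ := by gcongr
    have e2 : 3 * ‖y - p‖ ^ 2 / τ ≤ 3 * (3 * s) ^ 2 / τ := by gcongr
    have e3 : 3 * ‖x - p‖ ^ 2 / τ ≤ 3 * s ^ 2 / τ := by gcongr
    have e4 : 3 * (2 * s) ^ 2 / τ + 3 * (3 * s) ^ 2 / τ + 3 * s ^ 2 / τ = 42 / 200 * s := by
      rw [hτs]; field_simp; ring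
    linarith
  have h7 : w - (T p).starProjection w = (s / ‖v‖) • (v - (T p).starProjection v) := by
    rw [hw, map_smul, smul_sub]
  rw [h7, norm_smul, Real.norm_of_nonneg (by positivity), div_mul_eq_mul_div,
    div_le_iff₀ hvn] at h6
  have h8 : s * ‖v - (T p).starProjection v‖ ≤ s * (21 / 100 * ‖v‖) := by linarith
  exact le_of_mul_le_mul_left h8 hs0

/-- The projection to a tangent space is bi-Lipschitz near its base point. -/
theorem RegularTangents.norm_le_two_mul_proj (hT : RegularTangents K T) (hK : IsCompact K)
    (hu : UniqueNearest τ K) (hτ : 0 < τ) {p x y : E} (hp : p ∈ K) (hx : x ∈ K) (hy : y ∈ K)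
    (hxp : ‖x - p‖ ≤ τ / 200) (hyp : ‖y - p‖ ≤ τ / 200) :
    ‖y - x‖ ≤ 2 * ‖(T p).starProjection (y - x)‖ := by
  have hyx : ‖y - x‖ ≤ τ / 100 := by
    calc ‖y - x‖ = ‖(y - p) - (x - p)‖ := by congr 1; abel
      _ ≤ _ := norm_sub_le _ _
      _ ≤ _ := by linarith
  obtain ⟨v, hv, hvd⟩ := hT.exists_tangent_near hK hu hτ hx hy (by linarith)
  have h1 : 3 * ‖y - x‖ ^ 2 / τ ≤ 3 / 100 * ‖y - x‖ := by
    rw [div_le_iff₀ hτ]; nlinarith [norm_nonneg (y - x)]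
  have h2 := hT.norm_tangent_sub_proj_le hK hu hτ hx hp hxp hv
  have h3 := norm_sub_starProjection_le (T p) ((y - x) - v)
  have h4 : ‖v‖ ≤ ‖y - x‖ + ‖y - x - v‖ := by
    calc ‖v‖ = ‖(y - x) - (y - x - v)‖ := by congr 1; abel
      _ ≤ _ := norm_sub_le _ _
  -- The part of `y - x` lost in the projection is the lost part of the tangent vector `v` at `x`
  -- plus that of the remainder. Together they are below a quarter of `‖y - x‖`.
  have h5 : y - x = (T p).starProjection (y - x) + (v - (T p).starProjection v) +
      (((y - x) - v) - (T p).starProjection ((y - x) - v)) := by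
    simp only [map_sub]; abel
  have h6 : ‖y - x‖ ≤ ‖(T p).starProjection (y - x)‖ + ‖v - (T p).starProjection v‖ +
      ‖((y - x) - v) - (T p).starProjection ((y - x) - v)‖ := by
    conv_lhs => rw [h5]
    exact norm_add₃_le
  linarith [norm_nonneg (y - x)]

end TransformerApprox

end Tangent

/-! ### Submanifolds: tangent spaces, reach and geodesic distance -/

section Submanifold

open Metric Filter Topology RealInnerProductSpace

namespace TransformerApprox

/-! ### Tangent spaces defined by slice charts -/

section Chart

variable {E : Type*} [NormedAddCommGroup E] [InnerProductSpace ℝ E]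

/-- `φ` is a diffeomorphism that carries `K` to the linear subspace `L`. -/
structure SliceChart (K : Set E) (φ : OpenPartialHomeomorph E E) (L : Submodule ℝ E) : Prop where
  contDiffOn : ContDiffOn ℝ ∞ φ φ.source
  contDiffOn_symm : ContDiffOn ℝ ∞ φ.symm φ.target
  isImage : φ.IsImage K (L : Set E)

namespace SliceChart

variable {K : Set E} {φ : OpenPartialHomeomorph E E} {L : Submodule ℝ E}

theorem hasFDerivAt (h : SliceChart K φ L) {z : E} (hz : z ∈ φ.source) :
    HasFDerivAt φ (fderiv ℝ φ z) z :=
  ((h.contDiffOn.contDiffAt (φ.open_source.mem_nhds hz)).differentiableAt (by simp)).hasFDerivAt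

theorem hasFDerivAt_symm (h : SliceChart K φ L) {z : E} (hz : z ∈ φ.source) :
    HasFDerivAt φ.symm (fderiv ℝ φ.symm (φ z)) (φ z) :=
  ((h.contDiffOn_symm.contDiffAt (φ.open_target.mem_nhds (φ.map_source hz))).differentiableAt
    (by simp)).hasFDerivAt

theorem symm_comp (h : SliceChart K φ L) {z : E} (hz : z ∈ φ.source) (v : E) :
    fderiv ℝ φ.symm (φ z) (fderiv ℝ φ z v) = v := by
  have h1 := (h.hasFDerivAt_symm hz).comp z (h.hasFDerivAt hz)
  have h2 : HasFDerivAt (φ.symm ∘ φ) (ContinuousLinearMap.id ℝ E) z :=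
    (hasFDerivAt_id z).congr_of_eventuallyEq (φ.eventually_left_inverse hz)
  exact DFunLike.congr_fun (h1.unique h2) v

theorem comp_symm (h : SliceChart K φ L) {z : E} (hz : z ∈ φ.source) (v : E) :
    fderiv ℝ φ z (fderiv ℝ φ.symm (φ z) v) = v := by
  have h3 := h.hasFDerivAt hz
  rw [← φ.left_inv hz] at h3
  have h1 := h3.comp (φ z) (h.hasFDerivAt_symm hz)
  rw [φ.left_inv hz] at h1
  have h2 : HasFDerivAt (φ ∘ φ.symm) (ContinuousLinearMap.id ℝ E) (φ z) :=
    (hasFDerivAt_id (φ z)).congr_of_eventuallyEq (φ.eventually_right_inverse (φ.map_source hz))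
  exact DFunLike.congr_fun (h1.unique h2) v

theorem exists_velocity (h : SliceChart K φ L) {z : E} (hz : z ∈ φ.source) (hzK : z ∈ K) {v : E}
    (hv : fderiv ℝ φ z v ∈ L) :
    ∃ γ : ℝ → E, γ 0 = z ∧ HasDerivAt γ v 0 ∧ ∀ᶠ t in 𝓝 0, γ t ∈ K := by
  set u := fderiv ℝ φ z v with hu
  have hline : HasDerivAt (fun t : ℝ => φ z + t • u) u 0 := by
    simpa using ((hasDerivAt_id (0 : ℝ)).smul_const u).const_add (φ z)
  refine ⟨fun t => φ.symm (φ z + t • u), by simp [φ.left_inv hz], ?_, ?_⟩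
  · have h1 := h.hasFDerivAt_symm hz
    have h2 := HasFDerivAt.comp_hasDerivAt_of_eq (0 : ℝ) h1 hline (by simp)
    rwa [hu, h.symm_comp hz] at h2
  · have h3 : ∀ᶠ t in 𝓝 (0 : ℝ), φ z + t • u ∈ φ.target := by
      refine hline.continuousAt.eventually_mem (φ.open_target.mem_nhds ?_)
      simpa using φ.map_source hz
    filter_upwards [h3] with t ht
    rw [← h.isImage (φ.map_target ht), φ.right_inv ht]
    exact L.add_mem ((h.isImage hz).2 hzK) (L.smul_mem t hv)

/-- The chart sends secants of `K` to vectors of `L`, and `L` is closed. -/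
theorem fderiv_mem_of_secant [FiniteDimensional ℝ E] (h : SliceChart K φ L) {z : E}
    (hz : z ∈ φ.source) (hzK : z ∈ K)
    {m : ℕ → E} {v : E} (hm : ∀ᶠ n in atTop, m n ∈ K) (hmz : Tendsto m atTop (𝓝 z))
    {c : ℕ → ℝ} (hc : Tendsto (fun n => c n • (m n - z)) atTop (𝓝 v)) : fderiv ℝ φ z v ∈ L := by
  have h1 := (h.hasFDerivAt hz).hasFDerivWithinAt (s := Set.univ) |>.lim
    (by simpa using hmz.sub_const z) (by simp) hc
  have hcl : IsClosed (L : Set E) := L.closed_of_finiteDimensional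
  refine hcl.mem_of_tendsto h1 ?_
  filter_upwards [hm, hmz.eventually_mem (φ.open_source.mem_nhds hz)] with n hn hn2
  rw [add_sub_cancel]
  exact L.smul_mem _ (L.sub_mem ((h.isImage hn2).2 hn) ((h.isImage hz).2 hzK))

theorem finrank_comap [FiniteDimensional ℝ E] (h : SliceChart K φ L) {z : E}
    (hz : z ∈ φ.source) :
    Module.finrank ℝ (L.comap (fderiv ℝ φ z : E →ₗ[ℝ] E)) = Module.finrank ℝ L := by
  let e : E ≃ₗ[ℝ] E := LinearEquiv.ofLinearMap (fderiv ℝ φ.symm (φ z) : E →ₗ[ℝ] E)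
    (fderiv ℝ φ z : E →ₗ[ℝ] E) (LinearMap.ext fun v => h.symm_comp hz v)
    (LinearMap.ext fun v => h.comp_symm hz v)
  have h1 : L.comap (fderiv ℝ φ z : E →ₗ[ℝ] E) = L.map (e : E →ₗ[ℝ] E) :=
    (Submodule.map_equiv_eq_comap_symm e L).symm
  rw [h1]
  exact LinearEquiv.finrank_map_eq e L

/-- The chart at `x` transports a tangent vector `e` at `x` to a tangent vector at a nearby `z`. By
continuity of the derivative the two differ by less than `‖e‖`, so they cannot be orthogonal unless
`e = 0`. -/
theorem eventually_transversal (h : SliceChart K φ L) {x : E} (hx : x ∈ φ.source) :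
    ∀ᶠ z in 𝓝 x, z ∈ φ.source ∧ ∀ e, fderiv ℝ φ x e ∈ L →
      (∀ w, fderiv ℝ φ z w ∈ L → ⟪e, w⟫ = 0) → e = 0 := by
  have hc : ContinuousAt (fun z => fderiv ℝ φ.symm (φ z)) x := by
    have h1 : ContinuousOn (fderiv ℝ φ.symm) φ.target :=
      h.contDiffOn_symm.continuousOn_fderiv_of_isOpen φ.open_target (by simp)
    exact ContinuousAt.comp (g := fderiv ℝ φ.symm)
      (h1.continuousAt (φ.open_target.mem_nhds (φ.map_source hx))) (φ.continuousAt hx)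
  have hev : ∀ᶠ z in 𝓝 x, ‖fderiv ℝ φ.symm (φ x) - fderiv ℝ φ.symm (φ z)‖ * ‖fderiv ℝ φ x‖ < 1 := by
    have h2 : ContinuousAt
        (fun z => ‖fderiv ℝ φ.symm (φ x) - fderiv ℝ φ.symm (φ z)‖ * ‖fderiv ℝ φ x‖) x :=
      (continuousAt_const.sub hc).norm.mul continuousAt_const
    exact h2.eventually_lt continuousAt_const (by simp)
  filter_upwards [φ.open_source.mem_nhds hx, hev] with z hz hlt
  refine ⟨hz, fun e he hw => ?_⟩
  by_contra he0
  have hen : 0 < ‖e‖ := norm_pos_iff.2 he0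
  set A := fderiv ℝ φ.symm (φ x) with hA
  set B := fderiv ℝ φ.symm (φ z) with hB
  set u := fderiv ℝ φ x e with hu
  have h1 : ⟪e, B u⟫ = 0 := hw _ (by rw [hB, h.comp_symm hz]; exact he)
  have h2 : A u = e := h.symm_comp hx e
  have h3 : ‖e‖ ^ 2 = ⟪e, (A - B) u⟫ := by
    rw [sub_apply, inner_sub_right, h1, h2, sub_zero, real_inner_self_eq_norm_sq]
  have h4 : ⟪e, (A - B) u⟫ ≤ ‖e‖ * (‖A - B‖ * (‖fderiv ℝ φ x‖ * ‖e‖)) :=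
    (real_inner_le_norm _ _).trans (by
      gcongr
      refine ((A - B).le_opNorm u).trans ?_
      gcongr
      exact (fderiv ℝ φ x).le_opNorm e)
  nlinarith [mul_pos hen hen]

end SliceChart

theorem regularTangents_of_sliceChart [FiniteDimensional ℝ E] {K : Set E}
    {φ : E → OpenPartialHomeomorph E E} {L : E → Submodule ℝ E}
    (hφ : ∀ z ∈ K, z ∈ (φ z).source ∧ SliceChart K (φ z) (L z)) :
    RegularTangents K (fun z => (L z).comap (fderiv ℝ (φ z) z : E →ₗ[ℝ] E)) := by
  have hsec : ∀ z ∈ K, ∀ (m : ℕ → E) (v : E),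
      (∀ᶠ n in atTop, m n ∈ K) → Tendsto m atTop (𝓝 z) → ∀ c : ℕ → ℝ,
      Tendsto (fun n => c n • (m n - z)) atTop (𝓝 v) → fderiv ℝ (φ z) z v ∈ L z :=
    fun z hz m v hm hmz c hc => (hφ z hz).2.fderiv_mem_of_secant (hφ z hz).1 hz hm hmz hc
  refine ⟨fun z hz v hv => ?_, hsec, fun x hx => ?_⟩
  · exact (hφ z hz).2.exists_velocity (hφ z hz).1 hz (Submodule.mem_comap.1 hv)
  have htr := (hφ x hx).2.eventually_transversal (hφ x hx).1
  filter_upwards [nhdsWithin_le_nhds htr, self_mem_nhdsWithin] with z ⟨hzs, hz⟩ hzM e he hw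
  refine hz e (Submodule.mem_comap.1 he) fun w hwL => hw w (Submodule.mem_comap.2 ?_)
  -- The tangent space at `z` is defined by the chart at `z`, while `w` is tangent for the chart at
  -- `x`. A curve from the latter chart supplies secants for the former, so no transition map is
  -- needed.
  obtain ⟨γ, hγ0, hγd, hγM⟩ := (hφ x hx).2.exists_velocity hzs hzM hwL
  have hlim : Tendsto (fun n : ℕ => 1 / ((n : ℝ) + 1)) atTop (𝓝 0) :=
    tendsto_one_div_add_atTop_nhds_zero_nat
  refine hsec z hzM (fun n : ℕ => γ (1 / ((n : ℝ) + 1))) w (hlim.eventually hγM) ?_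
    (fun n => (n : ℝ) + 1) ?_
  · rw [← hγ0]
    exact hγd.continuousAt.tendsto.comp hlim
  · have h2 := hγd.tendsto_slope_zero
    have h3 : Tendsto (fun n : ℕ => 1 / ((n : ℝ) + 1)) atTop (𝓝[≠] 0) :=
      tendsto_nhdsWithin_iff.2 ⟨hlim, Eventually.of_forall fun n => by
        simp only [Set.mem_compl_iff, Set.mem_singleton_iff]; positivity⟩
    have h4 := h2.comp h3
    refine h4.congr fun n => ?_
    simp [hγ0]

end Chart

/-! ### Consequences of the reach bound for distances -/

variable {D : ℕ}

theorem IsSmoothSubmanifold.exists_regularTangents {d : ℕ} {𝓜 : Set (EuclideanSpace ℝ (Fin D))}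
    (h : IsSmoothSubmanifold d 𝓜) :
    ∃ T : EuclideanSpace ℝ (Fin D) → Submodule ℝ (EuclideanSpace ℝ (Fin D)),
      RegularTangents 𝓜 T ∧ ∀ z ∈ 𝓜, Module.finrank ℝ (T z) = d := by
  have h' : ∀ p, ∃ (φ : OpenPartialHomeomorph (EuclideanSpace ℝ (Fin D))
      (EuclideanSpace ℝ (Fin D))) (L : Submodule ℝ (EuclideanSpace ℝ (Fin D))),
      p ∈ 𝓜 → (p ∈ φ.source ∧ SliceChart 𝓜 φ L) ∧ Module.finrank ℝ L = d := by
    intro p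
    by_cases hp : p ∈ 𝓜
    · obtain ⟨φ, L, h1, h2, h3, h4, h5⟩ := h p hp
      exact ⟨φ, L, fun _ => ⟨⟨h1, h3, h4, h5⟩, h2⟩⟩
    · exact ⟨OpenPartialHomeomorph.refl _, ⊥, fun hp' => absurd hp' hp⟩
  choose φ L hφ using h'
  exact ⟨_, regularTangents_of_sliceChart fun z hz => (hφ z hz).1,
    fun z hz => ((hφ z hz).1.2.finrank_comap (hφ z hz).1.1).trans (hφ z hz).2⟩

theorem uniqueNearest_of_le_reach {τ : ℝ} {𝓜 : Set (EuclideanSpace ℝ (Fin D))}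
    (h : ENNReal.ofReal τ ≤ reach 𝓜) : UniqueNearest τ 𝓜 := by
  intro v hv p hp q hq hvp hvq
  by_contra hne
  have hpos : 0 < τ := infDist_nonneg.trans_lt hv
  have hfin : infEDist v 𝓜 ≠ ⊤ := infEDist_ne_top ⟨p, hp⟩
  have hed : ∀ r, dist v r = infDist v 𝓜 → edist r v = infEDist v 𝓜 := by
    intro r hr
    rw [edist_comm, edist_dist, hr, infDist, ENNReal.ofReal_toReal hfin]
  have h1 : reach 𝓜 ≤ edist p v :=
    sInf_le ⟨p, hp, q, hq, hne, v, rfl, by rw [hed p hvp, hed q hvq], hed q hvq⟩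
  have h2 : edist p v < ENNReal.ofReal τ := by
    rw [edist_comm, edist_dist, hvp]
    exact (ENNReal.ofReal_lt_ofReal_iff hpos).2 hv
  exact absurd (h.trans h1) (not_le.2 h2)

/-- The segment from `0` to the projection of `y - x` in the tangent space at `x` lifts to a curve
in `𝓜` from `x` to `y`. The inverse projection is 2-Lipschitz, which bounds its length. The radius
is `τ / 400` since lifting may double the length and the curve must stay within `τ / 200`. -/
theorem RegularTangents.geodesicEDist_le {τ : ℝ} {𝓜 : Set (EuclideanSpace ℝ (Fin D))}
    {T : EuclideanSpace ℝ (Fin D) → Submodule ℝ (EuclideanSpace ℝ (Fin D))}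
    (hT : RegularTangents 𝓜 T) (hK : IsCompact 𝓜) (hu : UniqueNearest τ 𝓜) (hτ : 0 < τ)
    (x y : 𝓜) (hxy : dist x y ≤ τ / 400) :
    geodesicEDist x y ≤ ENNReal.ofReal (2 * dist x y) := by
  obtain ⟨x, hx⟩ := x
  obtain ⟨y, hy⟩ := y
  rw [Subtype.dist_eq, dist_comm, dist_eq_norm] at hxy ⊢
  simp only at hxy ⊢
  set π := (T x).starProjection with hπ
  set u := π (y - x) with hu'
  have hun : ‖u‖ ≤ ‖y - x‖ := (T x).norm_starProjection_apply_le _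
  have huT : u ∈ T x := Submodule.starProjection_apply_mem _ _
  have hlift : ∀ t : unitInterval, ∃ z ∈ 𝓜, π (z - x) = (t : ℝ) • u ∧ ‖z - x‖ ≤ τ / 200 := by
    intro t
    have hn : ‖(t : ℝ) • u‖ ≤ τ / 400 := by
      rw [norm_smul, Real.norm_of_nonneg t.2.1]
      exact (mul_le_of_le_one_left (norm_nonneg _) t.2.2).trans (by linarith)
    obtain ⟨z, hz, hz1, hz2⟩ := hT.exists_lift hK hu hτ hx ((T x).smul_mem (t : ℝ) huT)
      (by linarith)
    exact ⟨z, hz, hz1, by linarith⟩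
  choose g hg hgπ hgn using hlift
  have hinj : ∀ z ∈ 𝓜, ∀ z' ∈ 𝓜, ‖z - x‖ ≤ τ / 200 → ‖z' - x‖ ≤ τ / 200 →
      dist z z' ≤ 2 * ‖π (z - x) - π (z' - x)‖ := by
    intro z hz z' hz' h1 h2
    have h3 := hT.norm_le_two_mul_proj hK hu hτ hx hz' hz h2 h1
    rw [dist_eq_norm, ← map_sub, sub_sub_sub_cancel_right]
    exact h3
  -- The lifts were chosen pointwise; the bi-Lipschitz bound makes the choice unique and Lipschitz.
  have hLip : LipschitzWith (Real.toNNReal (2 * ‖y - x‖)) g := by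
    refine LipschitzWith.of_dist_le_mul fun s t => ?_
    rw [Real.coe_toNNReal _ (by positivity)]
    refine (hinj _ (hg s) _ (hg t) (hgn s) (hgn t)).trans ?_
    rw [hgπ, hgπ, ← sub_smul, norm_smul, Subtype.dist_eq, Real.dist_eq, Real.norm_eq_abs]
    calc 2 * (|(s : ℝ) - t| * ‖u‖) ≤ 2 * (|(s : ℝ) - t| * ‖y - x‖) := by gcongr
      _ = _ := by ring
  have h0 : g 0 = x := by
    have := hinj _ (hg 0) x hx (hgn 0) (by simp; positivity)
    rw [hgπ] at this
    simpa using this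
  have h1 : g 1 = y := by
    have := hinj _ (hg 1) y hy (hgn 1) (by linarith)
    rw [hgπ] at this
    simpa [hu'] using this
  let γ : Path (⟨x, hx⟩ : 𝓜) ⟨y, hy⟩ :=
    { toFun := fun t => ⟨g t, hg t⟩
      continuous_toFun := hLip.continuous.subtype_mk _
      source' := Subtype.ext h0
      target' := Subtype.ext h1 }
  refine (iInf_le _ γ).trans ?_
  have h2 : eVariationOn (g ∘ id) Set.univ ≤
      (Real.toNNReal (2 * ‖y - x‖) : ℝ≥0) * eVariationOn (id : unitInterval → unitInterval)
        Set.univ :=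
    (hLip.lipschitzOnWith (s := Set.univ)).comp_eVariationOn_le (Set.mapsTo_univ _ _)
  have h3 : eVariationOn (id : unitInterval → unitInterval) Set.univ ≤ 1 := by
    have h4 : MonotoneOn (fun t : unitInterval => (t : ℝ)) Set.univ := fun a _ b _ hab => hab
    have h5 := h4.eVariationOn_eq (a := 0) (b := 1) (Set.mem_univ _) (Set.mem_univ _)
    have h6 : (Set.univ : Set unitInterval) ∩ Set.Icc 0 1 = Set.univ := by
      ext t; simpa using unitInterval.le_one' (t := t)
    rw [h6] at h5
    have h7 : eVariationOn (fun t : unitInterval => (t : ℝ)) Set.univ =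
      eVariationOn (id : unitInterval → unitInterval) Set.univ := rfl
    rw [← h7]
    exact h5.le.trans (by simp)
  calc eVariationOn (g ∘ id) Set.univ ≤ _ := h2
    _ ≤ (Real.toNNReal (2 * ‖y - x‖) : ℝ≥0) * 1 := by gcongr
    _ = _ := by rw [mul_one]; rfl

/-- A Hölder function for the geodesic distance is locally Hölder for the Euclidean one. -/
theorem IsHolder.abs_sub_le {τ H β : ℝ} (hH : 0 < H) (hβ : 0 < β)
    {𝓜 : Set (EuclideanSpace ℝ (Fin D))}
    {T : EuclideanSpace ℝ (Fin D) → Submodule ℝ (EuclideanSpace ℝ (Fin D))}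
    (hT : RegularTangents 𝓜 T) (hK : IsCompact 𝓜) (hu : UniqueNearest τ 𝓜) (hτ : 0 < τ)
    {f : 𝓜 → ℝ} (hf : IsHolder H β f) (x y : 𝓜) {r : ℝ} (hr : r ≤ τ / 400) (hxy : dist x y ≤ r) :
    |f x - f y| ≤ H * (2 * r) ^ β := by
  have h1 := hf x y
  have h2 := hT.geodesicEDist_le hK hu hτ x y (hxy.trans hr)
  have hr0 : 0 ≤ r := dist_nonneg.trans hxy
  have h3 : edist (f x) (f y) ≤ ENNReal.ofReal (H * (2 * r) ^ β) := by
    refine h1.trans ?_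
    rw [ENNReal.ofReal_mul hH.le, ← ENNReal.ofReal_rpow_of_nonneg (by positivity) hβ.le]
    gcongr
    exact h2.trans (ENNReal.ofReal_le_ofReal (by linarith))
  rw [edist_dist, ENNReal.ofReal_le_ofReal_iff (by positivity), Real.dist_eq] at h3
  exact h3

end TransformerApprox

end Submanifold

/-! ### Covering numbers and the lattice cells that meet a submanifold -/

section Covering

open Metric Filter Topology

namespace TransformerApprox

/-- `A` is covered by at most `B` sets of diameter at most `h`. -/
def SmallCover {X : Type*} [PseudoMetricSpace X] (A : Set X) (h B : ℝ) : Prop :=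
  ∃ F : Finset (Set X), (F.card : ℝ) ≤ B ∧ A ⊆ ⋃ P ∈ F, P ∧
    ∀ P ∈ F, ∀ x ∈ P, ∀ y ∈ P, dist x y ≤ h

namespace SmallCover

variable {X Y : Type*} [PseudoMetricSpace X] [PseudoMetricSpace Y]

open Classical in
theorem of_image {A : Set X} {f : X → Y} {h h' B c : ℝ} (hc : 0 ≤ c) (hf : SmallCover (f '' A) h B)
    (hch : c * h ≤ h') (hd : ∀ x ∈ A, ∀ y ∈ A, dist x y ≤ c * dist (f x) (f y)) :
    SmallCover A h' B := by
  obtain ⟨F, hcard, hcov, hdiam⟩ := hf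
  refine ⟨F.image fun P => f ⁻¹' P ∩ A, ?_, fun x hx => ?_, ?_⟩
  · exact le_trans (by exact_mod_cast Finset.card_image_le) hcard
  · have h1 := hcov ⟨x, hx, rfl⟩
    simp only [Set.mem_iUnion, exists_prop] at h1 ⊢
    obtain ⟨P, hP, hxP⟩ := h1
    exact ⟨_, Finset.mem_image_of_mem _ hP, hxP, hx⟩
  · intro Q hQ
    obtain ⟨P, hP, rfl⟩ := Finset.mem_image.1 hQ
    intro x hx y hy
    refine (hd x hx.2 y hy.2).trans (le_trans ?_ hch)
    gcongr
    exact hdiam P hP _ hx.1 _ hy.1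

open Classical in
theorem iUnion {ι : Type*} (s : Finset ι) {A : Set X} {P : ι → Set X} {h B : ℝ}
    (hA : A ⊆ ⋃ i ∈ s, P i) (hP : ∀ i ∈ s, SmallCover (P i) h B) :
    SmallCover A h (s.card * B) := by
  have h1 : ∀ i, ∃ F : Finset (Set X), i ∈ s → (F.card : ℝ) ≤ B ∧ P i ⊆ ⋃ Q ∈ F, Q ∧
    ∀ Q ∈ F, ∀ x ∈ Q, ∀ y ∈ Q, dist x y ≤ h := by
    intro i
    by_cases hi : i ∈ s
    · obtain ⟨F, h1⟩ := hP i hi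
      exact ⟨F, fun _ => h1⟩
    · exact ⟨∅, fun h => absurd h hi⟩
  choose F hF using h1
  refine ⟨s.biUnion F, ?_, fun x hx => ?_, ?_⟩
  · calc ((s.biUnion F).card : ℝ) ≤ ∑ i ∈ s, ((F i).card : ℝ) := by
          exact_mod_cast Finset.card_biUnion_le
      _ ≤ ∑ i ∈ s, B := Finset.sum_le_sum fun i hi => (hF i hi).1
      _ = s.card * B := by rw [Finset.sum_const, nsmul_eq_mul]
  · have h2 := hA hx
    simp only [Set.mem_iUnion, exists_prop] at h2
    obtain ⟨i, hi, hxi⟩ := h2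
    have h3 := (hF i hi).2.1 hxi
    simp only [Set.mem_iUnion, exists_prop] at h3 ⊢
    obtain ⟨Q, hQ, hxQ⟩ := h3
    exact ⟨Q, Finset.mem_biUnion.2 ⟨i, hi, hQ⟩, hxQ⟩
  · intro Q hQ
    obtain ⟨i, hi, hQi⟩ := Finset.mem_biUnion.1 hQ
    exact (hF i hi).2.2 Q hQi

theorem refine {A : Set X} {h h' B B' : ℝ} (hA : SmallCover A h B) (hB' : 0 ≤ B')
    (hP : ∀ P ⊆ A, (∀ x ∈ P, ∀ y ∈ P, dist x y ≤ h) → SmallCover P h' B') :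
    SmallCover A h' (B * B') := by
  obtain ⟨F, hcard, hcov, hdiam⟩ := hA
  have h1 : SmallCover A h' (F.card * B') := by
    refine iUnion F (P := fun P => P ∩ A) (fun x hx => ?_) fun P hPP => ?_
    · have h2 := hcov hx
      simp only [Set.mem_iUnion, exists_prop] at h2 ⊢
      obtain ⟨P, hP, hxP⟩ := h2
      exact ⟨P, hP, hxP, hx⟩
    · exact hP _ Set.inter_subset_right fun x hx y hy => hdiam P hPP x hx.1 y hy.1
  obtain ⟨G, h2, h3⟩ := h1
  exact ⟨G, h2.trans (by gcongr), h3⟩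

end SmallCover

theorem norm_le_of_abs_le {n : ℕ} {x : EuclideanSpace ℝ (Fin n)} {a : ℝ} (ha : 0 ≤ a)
    (hx : ∀ i, |x i| ≤ a) : ‖x‖ ≤ (n + 1) * a := by
  rw [EuclideanSpace.norm_eq]
  refine Real.sqrt_le_iff.2 ⟨by positivity, ?_⟩
  calc ∑ i, ‖x i‖ ^ 2 ≤ ∑ _i : Fin n, a ^ 2 :=
        Finset.sum_le_sum fun i _ => by rw [Real.norm_eq_abs]; gcongr; exact hx i
    _ = n * a ^ 2 := by simp
    _ ≤ ((n + 1) * a) ^ 2 := by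
      rw [mul_pow]
      gcongr
      have : (0 : ℝ) ≤ n := Nat.cast_nonneg n
      nlinarith

theorem abs_coord_le_norm {n : ℕ} (x : EuclideanSpace ℝ (Fin n)) (i : Fin n) : |x i| ≤ ‖x‖ := by
  simpa using PiLp.norm_apply_le x i

theorem abs_sub_lt_of_floor_eq {a b : ℝ} (h : ⌊a⌋ = ⌊b⌋) : |a - b| < 1 := by
  have h1 := Int.floor_le a
  have h2 := Int.lt_floor_add_one a
  have h3 := Int.floor_le b
  have h4 := Int.lt_floor_add_one b
  rw [h] at h1 h2
  rw [abs_lt]; constructor <;> linarith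

open Classical in
-- Cut by a cubic grid of side `h / (n + 1)`. The crude factor `n + 1` in place of `√n` keeps the
-- side defined for `n = 0`.
theorem smallCover_closedBall (n : ℕ) {ρ h : ℝ} (hρ : 0 ≤ ρ) (hh : 0 < h) :
    SmallCover (closedBall (0 : EuclideanSpace ℝ (Fin n)) ρ) h
      ((2 * ρ * (n + 1) / h + 2) ^ n) := by
  set a := h / (n + 1) with ha
  have ha0 : 0 < a := by positivity
  set cell : (Fin n → ℤ) → Set (EuclideanSpace ℝ (Fin n)) :=
    fun k => {x | ∀ i, ⌊x i / a⌋ = k i} with hcell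
  refine ⟨(Fintype.piFinset fun _ : Fin n => Finset.Icc ⌊-(ρ / a)⌋ ⌊ρ / a⌋).image cell, ?_, ?_, ?_⟩
  · have h1 : ((Finset.Icc ⌊-(ρ / a)⌋ ⌊ρ / a⌋).card : ℝ) ≤ 2 * ρ * (n + 1) / h + 2 := by
      have h2 : ⌊-(ρ / a)⌋ ≤ ⌊ρ / a⌋ + 1 := by
        have : ⌊-(ρ / a)⌋ ≤ ⌊ρ / a⌋ := Int.floor_le_floor
          ((neg_nonpos.2 (by positivity)).trans (by positivity))
        linarith
      rw [Int.card_Icc]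
      have h3 : (((⌊ρ / a⌋ + 1 - ⌊-(ρ / a)⌋).toNat : ℤ) : ℝ) =
          ((⌊ρ / a⌋ + 1 - ⌊-(ρ / a)⌋ : ℤ) : ℝ) := by
        rw [Int.toNat_of_nonneg (by linarith)]
      rw [Int.cast_natCast] at h3
      rw [h3]
      push_cast
      have h4 := Int.floor_le (ρ / a)
      have h5 := Int.lt_floor_add_one (-(ρ / a))
      have h6 : ρ / a + ρ / a = 2 * ρ * (n + 1) / h := by rw [ha]; field_simp; ring
      linarith
    calc _ ≤ ((Fintype.piFinset fun _ : Fin n => Finset.Icc ⌊-(ρ / a)⌋ ⌊ρ / a⌋).card : ℝ) := by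
          exact_mod_cast Finset.card_image_le
      _ = ((Finset.Icc ⌊-(ρ / a)⌋ ⌊ρ / a⌋).card : ℝ) ^ n := by
          rw [Fintype.card_piFinset]; simp
      _ ≤ _ := by gcongr
  · intro x hx
    rw [mem_closedBall_zero_iff] at hx
    simp only [Set.mem_iUnion, exists_prop]
    refine ⟨cell fun i => ⌊x i / a⌋, Finset.mem_image_of_mem _ ?_, fun i => rfl⟩
    rw [Fintype.mem_piFinset]
    intro i
    have h1 := abs_le.1 ((abs_coord_le_norm x i).trans hx)
    rw [Finset.mem_Icc]
    constructor <;> apply Int.floor_le_floor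
    · rw [← neg_div]; gcongr; exact h1.1
    · gcongr; exact h1.2
  · intro P hP
    obtain ⟨k, -, rfl⟩ := Finset.mem_image.1 hP
    intro x hx y hy
    rw [dist_eq_norm]
    have h1 : h = (n + 1) * a := by rw [ha]; field_simp
    rw [h1]
    refine norm_le_of_abs_le ha0.le fun i => ?_
    have h2 := abs_sub_lt_of_floor_eq ((hx i).trans (hy i).symm)
    rw [← sub_div, abs_div, abs_of_pos ha0, div_lt_one ha0] at h2
    exact h2.le

variable {D : ℕ}

/-- Two scales are used. An ambient grid cuts each chart ball into pieces of diameter `τ / 200`, at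
a cost independent of `δ`. On such a piece the projection to the tangent space at one of its points
has a 2-Lipschitz inverse, so a `d`-dimensional grid of mesh `δ / 2` suffices; hence the exponent
`d` instead of `D`. -/
theorem RegularTangents.smallCover {τ : ℝ} {𝓜 : Set (EuclideanSpace ℝ (Fin D))}
    {T : EuclideanSpace ℝ (Fin D) → Submodule ℝ (EuclideanSpace ℝ (Fin D))}
    (hT : RegularTangents 𝓜 T) (hK : IsCompact 𝓜) (hu : UniqueNearest τ 𝓜) (hτ : 0 < τ)
    {N d : ℕ} (hd : ∀ z ∈ 𝓜, Module.finrank ℝ (T z) = d) (hN : HasChartCover τ N 𝓜)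
    {δ : ℝ} (hδ : 0 < δ) :
    SmallCover 𝓜 δ (N * ((100 * (D + 1) + 2) ^ D * (τ * (d + 1) / (50 * δ) + 2) ^ d)) := by
  obtain ⟨r, hr, hrτ, c, hc, hcov⟩ := hN
  have h0 : SmallCover 𝓜 δ ((Finset.univ : Finset (Fin N)).card *
      ((100 * (D + 1) + 2) ^ D * (τ * (d + 1) / (50 * δ) + 2) ^ d)) := by
    refine SmallCover.iUnion Finset.univ (P := fun n => 𝓜 ∩ ball (c n) r) (fun x hx => ?_)
      fun n _ => ?_
    · have := hcov hx
      simp only [Set.mem_iUnion] at this ⊢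
      obtain ⟨n, hn⟩ := this
      exact ⟨n, Finset.mem_univ _, hx, hn⟩
    · have h1 : SmallCover (𝓜 ∩ ball (c n) r) (τ / 200) ((100 * (D + 1) + 2) ^ D) := by
        have h2 := smallCover_closedBall D (ρ := τ / 4) (h := τ / 200) (by positivity)
          (by positivity)
        rw [show 2 * (τ / 4) * ((D : ℝ) + 1) / (τ / 200) + 2 = 100 * (D + 1) + 2 by
          field_simp; ring] at h2
        refine SmallCover.of_image (f := fun x => x - c n) (c := 1) zero_le_one ?_
          (one_mul _).le (fun x _ y _ => by simp)
        obtain ⟨F, h3, h4, h5⟩ := h2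
        refine ⟨F, h3, Set.Subset.trans ?_ h4, h5⟩
        rintro _ ⟨x, ⟨-, hx⟩, rfl⟩
        rw [mem_ball, dist_eq_norm] at hx
        rw [mem_closedBall_zero_iff]
        linarith
      refine h1.refine (by positivity) fun P hP hPd => ?_
      rcases P.eq_empty_or_nonempty with rfl | ⟨p, hp⟩
      · exact ⟨∅, by simp; positivity, by simp, by simp⟩
      have hpM := (hP hp).1
      have h2 := smallCover_closedBall d (ρ := τ / 200) (h := δ / 2) (by positivity)
          (by positivity)
      rw [show 2 * (τ / 200) * ((d : ℝ) + 1) / (δ / 2) + 2 = τ * (d + 1) / (50 * δ) + 2 by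
          field_simp; ring] at h2
      let e : T p ≃ₗᵢ[ℝ] EuclideanSpace ℝ (Fin d) :=
        ((stdOrthonormalBasis ℝ (T p)).reindex (finCongr (hd p hpM))).repr
      refine SmallCover.of_image (f := fun x => e ((T p).orthogonalProjectionOnto (x - p))) (c := 2)
        (h := δ / 2) (by norm_num) ?_ (by linarith) ?_
      · obtain ⟨F, h3, h4, h5⟩ := h2
        refine ⟨F, h3, Set.Subset.trans ?_ h4, h5⟩
        rintro _ ⟨x, hx, rfl⟩
        rw [mem_closedBall_zero_iff, e.norm_map]
        refine ((T p).norm_orthogonalProjectionOnto_apply_le _).trans ?_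
        rw [← dist_eq_norm]
        exact hPd x hx p hp
      · intro x hx y hy
        have hx' := hPd x hx p hp
        have hy' := hPd y hy p hp
        rw [dist_eq_norm] at hx' hy'
        have h3 := hT.norm_le_two_mul_proj hK hu hτ hpM (hP hy).1 (hP hx).1 hy' hx'
        rw [e.dist_map, dist_eq_norm, dist_eq_norm, ← map_sub, sub_sub_sub_cancel_right]
        exact h3
  simpa using h0

/-- The corner of the lattice cell that contains `x / δ + (s, …, s)`. -/
noncomputable def cellIndex (δ : ℝ) (x : EuclideanSpace ℝ (Fin D)) (s : ℝ) : Fin D → ℤ :=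
  fun i => ⌊x i / δ + s⌋

open Classical in
-- In a set of diameter `δ`, each coordinate of `x / δ` is within `1` of that of a fixed point, and
-- the shift adds less than `1`. The floors then take at most four values per coordinate. Keeping
-- exactly the cells that are met gives every node a point of `A` at which to sample.
theorem SmallCover.exists_cells {A : Set (EuclideanSpace ℝ (Fin D))} {δ B : ℝ} (hδ : 0 < δ)
    (hA : SmallCover A δ B) :
    ∃ Λ : Finset (Fin D → ℤ), (Λ.card : ℝ) ≤ B * 4 ^ D ∧
      ∀ k, k ∈ Λ ↔ ∃ x ∈ A, ∃ s ∈ Set.Ico (0 : ℝ) 1, cellIndex δ x s = k := by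
  obtain ⟨F, hcard, hcov, hdiam⟩ := hA
  have hrep : ∀ P : Set (EuclideanSpace ℝ (Fin D)), ∃ p, P.Nonempty → p ∈ P := by
    intro P
    by_cases h : P.Nonempty
    · exact ⟨h.some, fun h' => h.some_mem⟩
    · exact ⟨0, fun h' => absurd h' h⟩
  choose p hp using hrep
  set Λ' : Finset (Fin D → ℤ) := F.biUnion fun P => Fintype.piFinset fun i : Fin D =>
    Finset.Icc (⌊p P i / δ⌋ - 1) (⌊p P i / δ⌋ + 2) with hΛ'
  have hmem : ∀ x ∈ A, ∀ s ∈ Set.Ico (0 : ℝ) 1, cellIndex δ x s ∈ Λ' := by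
    intro x hx s hs
    have h1 := hcov hx
    simp only [Set.mem_iUnion, exists_prop] at h1
    obtain ⟨P, hP, hxP⟩ := h1
    refine Finset.mem_biUnion.2 ⟨P, hP, Fintype.mem_piFinset.2 fun i => ?_⟩
    have h2 := (abs_coord_le_norm (x - p P) i).trans
      ((dist_eq_norm x (p P)).ge.trans (hdiam P hP x hxP _ (hp P ⟨x, hxP⟩)))
    rw [PiLp.sub_apply, abs_le] at h2
    have h3 : x i / δ ≤ p P i / δ + 1 := by
      rw [div_add_one hδ.ne']; gcongr; linarith
    have h4 : p P i / δ - 1 ≤ x i / δ := by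
      rw [div_sub_one hδ.ne']; gcongr; linarith
    have h5 := Int.floor_le (p P i / δ)
    have h6 := Int.lt_floor_add_one (p P i / δ)
    rw [Finset.mem_Icc]
    constructor
    · refine Int.le_floor.2 ?_
      push_cast
      linarith [hs.1]
    · refine Int.lt_add_one_iff.1 (Int.floor_lt.2 ?_)
      push_cast
      linarith [hs.2]
  refine ⟨Λ'.filter fun k => ∃ x ∈ A, ∃ s ∈ Set.Ico (0 : ℝ) 1, cellIndex δ x s = k, ?_, ?_⟩
  · calc _ ≤ (Λ'.card : ℝ) := by exact_mod_cast Finset.card_filter_le _ _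
      _ ≤ ∑ P ∈ F, ((Fintype.piFinset fun i : Fin D =>
          Finset.Icc (⌊p P i / δ⌋ - 1) (⌊p P i / δ⌋ + 2)).card : ℝ) := by
          exact_mod_cast Finset.card_biUnion_le
      _ = ∑ P ∈ F, (4 : ℝ) ^ D := by
          refine Finset.sum_congr rfl fun P _ => ?_
          rw [Fintype.card_piFinset]
          have : ∀ i, (Finset.Icc (⌊p P i / δ⌋ - 1) (⌊p P i / δ⌋ + 2)).card = 4 := by
            intro i
            rw [Int.card_Icc]
            omega
          simp [this]
      _ = F.card * 4 ^ D := by rw [Finset.sum_const, nsmul_eq_mul]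
      _ ≤ _ := by gcongr
  · intro k
    rw [Finset.mem_filter]
    refine ⟨fun h => h.2, fun h => ⟨?_, h⟩⟩
    obtain ⟨x, hx, s, hs, rfl⟩ := h
    exact hmem x hx s hs

end TransformerApprox

end Covering

/-! ### The nodal functions of the Kuhn triangulation -/

section Hat

open MeasureTheory

namespace TransformerApprox

variable {D : ℕ}

/-- The vector `y` together with the coordinate `0`. -/
def extendZero (y : Fin D → ℝ) : Option (Fin D) → ℝ := fun o => o.elim 0 y

/-- The nodal function at the origin of the Kuhn triangulation of `ℝ^D`, written as the length of
the set of shifts that move `y` into the unit cell. -/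
noncomputable def kuhnHat (y : Fin D → ℝ) : ℝ :=
  volume.real {s : ℝ | ∀ o, extendZero y o + s ∈ Set.Ico (0 : ℝ) 1}

/-- The admissible shifts form the interval from minus the least to `1` minus the greatest of the
extended coordinates, so the length is governed by the largest difference of two coordinates. This
is the form that a ReLU network can compute. -/
theorem kuhnHat_eq_relu {y : Fin D → ℝ} {m : ℝ}
    (hm : IsGreatest (Set.range fun p : Option (Fin D) × Option (Fin D) =>
      extendZero y p.1 - extendZero y p.2) m) :
    kuhnHat y = relu (1 - m) := by
  obtain ⟨⟨⟨i, j⟩, hij⟩, hub⟩ := hm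
  simp only at hij
  have hi : ∀ o, extendZero y o ≤ extendZero y i := by
    intro o
    have := hub ⟨(o, j), rfl⟩
    simp only at this
    linarith
  have hj : ∀ o, extendZero y j ≤ extendZero y o := by
    intro o
    have := hub ⟨(i, o), rfl⟩
    simp only at this
    linarith
  have hset : {s : ℝ | ∀ o, extendZero y o + s ∈ Set.Ico (0 : ℝ) 1} =
      Set.Ico (-extendZero y j) (1 - extendZero y i) := by
    ext s
    simp only [Set.mem_ofPred_eq, Set.mem_Ico]
    constructor
    · intro h
      exact ⟨by linarith [(h j).1], by linarith [(h i).2]⟩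
    · rintro ⟨h1, h2⟩ o
      exact ⟨by linarith [hj o], by linarith [hi o]⟩
  rw [kuhnHat, hset, Real.volume_real_Ico, relu, max_comm]
  congr 1
  linarith

/-- The shifts that move `x / δ` into the lattice cell with corner `k`. -/
def cellShifts (δ : ℝ) (x : EuclideanSpace ℝ (Fin D)) (k : Fin D → ℤ) : Set ℝ :=
  {s | s ∈ Set.Ico (0 : ℝ) 1 ∧ cellIndex δ x s = k}

/-- The extra coordinate `0` becomes the condition that the shift lies in `[0, 1)`, and the others
become floor equations. The nodal values at `x` are thus lengths of disjoint subsets of `[0, 1)`,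
whence the partition of unity. -/
theorem kuhnHat_eq (δ : ℝ) (x : EuclideanSpace ℝ (Fin D)) (k : Fin D → ℤ) :
    kuhnHat (fun i => x i / δ - k i) = volume.real (cellShifts δ x k) := by
  rw [kuhnHat]
  congr 1
  ext s
  simp only [cellShifts, Set.mem_ofPred_eq, Set.mem_Ico, Option.forall, extendZero, Option.elim_none,
    Option.elim_some, zero_add, cellIndex, funext_iff, Int.floor_eq_iff]
  refine and_congr Iff.rfl (forall_congr' fun i => ?_)
  constructor <;> rintro ⟨h1, h2⟩ <;> constructor <;> linarith

theorem measurableSet_cellShifts (δ : ℝ) (x : EuclideanSpace ℝ (Fin D)) (k : Fin D → ℤ) :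
    MeasurableSet (cellShifts δ x k) := by
  have h : cellShifts δ x k =
      Set.Ico (0 : ℝ) 1 ∩ ⋂ i, (fun s : ℝ => ⌊x i / δ + s⌋) ⁻¹' {k i} := by
    ext s
    simp [cellShifts, cellIndex, funext_iff]
  rw [h]
  refine measurableSet_Ico.inter (MeasurableSet.iInter fun i => ?_)
  exact (Int.measurable_floor.comp (measurable_const.add measurable_id)) (measurableSet_singleton _)

theorem volume_cellShifts_ne_top (δ : ℝ) (x : EuclideanSpace ℝ (Fin D)) (k : Fin D → ℤ) :
    volume (cellShifts δ x k) ≠ ⊤ :=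
  measure_ne_top_of_subset (fun _ hs => hs.1) (measure_Ico_lt_top (a := (0 : ℝ)) (b := 1)).ne

theorem kuhnHat_nonneg (y : Fin D → ℝ) : 0 ≤ kuhnHat y := measureReal_nonneg

theorem sum_kuhnHat_eq (δ : ℝ) (x : EuclideanSpace ℝ (Fin D)) (Λ : Finset (Fin D → ℤ)) :
    ∑ k ∈ Λ, kuhnHat (fun i => x i / δ - k i) = volume.real (⋃ k ∈ Λ, cellShifts δ x k) := by
  rw [measureReal_biUnion_finset (fun k _ k' _ hkk' => ?_)
    (fun k _ => measurableSet_cellShifts δ x k) (fun k _ => volume_cellShifts_ne_top δ x k)]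
  · exact Finset.sum_congr rfl fun k _ => kuhnHat_eq δ x k
  · exact Set.disjoint_left.2 fun s hs hs' => hkk' (hs.2.symm.trans hs'.2)

theorem sum_kuhnHat_le_one (δ : ℝ) (x : EuclideanSpace ℝ (Fin D)) (Λ : Finset (Fin D → ℤ)) :
    ∑ k ∈ Λ, kuhnHat (fun i => x i / δ - k i) ≤ 1 := by
  rw [sum_kuhnHat_eq]
  calc _ ≤ volume.real (Set.Ico (0 : ℝ) 1) :=
        measureReal_mono (Set.iUnion₂_subset fun k _ s hs => hs.1) measure_Ico_lt_top.ne
    _ = 1 := by simp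

theorem sum_kuhnHat_eq_one {δ : ℝ} {x : EuclideanSpace ℝ (Fin D)} {Λ : Finset (Fin D → ℤ)}
    (h : ∀ s ∈ Set.Ico (0 : ℝ) 1, cellIndex δ x s ∈ Λ) :
    ∑ k ∈ Λ, kuhnHat (fun i => x i / δ - k i) = 1 := by
  rw [sum_kuhnHat_eq]
  have : (⋃ k ∈ Λ, cellShifts δ x k) = Set.Ico (0 : ℝ) 1 := by
    refine Set.Subset.antisymm (Set.iUnion₂_subset fun k _ s hs => hs.1) fun s hs => ?_
    simp only [Set.mem_iUnion, exists_prop]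
    exact ⟨_, h s hs, hs, rfl⟩
  simp [this]

theorem exists_shift_of_kuhnHat_ne_zero {δ : ℝ} {x : EuclideanSpace ℝ (Fin D)} {k : Fin D → ℤ}
    (h : kuhnHat (fun i => x i / δ - k i) ≠ 0) : ∃ s ∈ Set.Ico (0 : ℝ) 1, cellIndex δ x s = k := by
  rw [kuhnHat_eq] at h
  by_contra! hcon
  refine h ?_
  have : cellShifts δ x k = ∅ := Set.eq_empty_of_forall_notMem fun s hs => hcon s hs.1 hs.2
  simp [this]

end TransformerApprox

end Hat

/-! ### The network -/

noncomputable section Network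

namespace TransformerApprox

theorem relu_of_nonneg {t : ℝ} (h : 0 ≤ t) : relu t = t := max_eq_right h

theorem relu_nonneg (t : ℝ) : 0 ≤ relu t := le_max_left _ _

theorem le_relu (t : ℝ) : t ≤ relu t := le_max_right _ _

theorem abs_single_le {e : ℕ} (a i : Fin e) (c : ℝ) :
    |(Pi.single a c : Fin e → ℝ) i| ≤ |c| := by
  by_cases h : i = a
  · subst h; simp
  · simp [h]

theorem AffineLayer.evalRelu_apply {p q : ℕ} (A : AffineLayer p q) (h : Fin p → ℝ) (i : Fin q) :
    A.evalRelu h i = relu (A.W i ⬝ᵥ h + A.b i) := rfl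

theorem AffineLayer.eval_apply {p q : ℕ} (A : AffineLayer p q) (h : Fin p → ℝ) (i : Fin q) :
    A.eval h i = A.W i ⬝ᵥ h + A.b i := rfl

/-! #### A feed-forward network that computes a maximum -/

section MaxNetwork

variable {e m : ℕ}

/-- The first of two hidden neurons whose sum is the running maximum. -/
abbrev runA : Fin (m + 2) := Fin.natAdd m 0

/-- The second of two hidden neurons whose sum is the running maximum. -/
abbrev runB : Fin (m + 2) := Fin.natAdd m 1

def maxFirst (ℓ : Fin m → Fin e → ℝ) : AffineLayer e (m + 2) where
  W := Fin.addCases ℓ fun _ => 0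
  b := 0

def maxStep (j : Fin m) : AffineLayer (m + 2) (m + 2) where
  W := Fin.addCases (fun i => Pi.single (Fin.castAdd 2 i) 1)
    ![Pi.single runA 1 + Pi.single runB 1,
      Pi.single (Fin.castAdd 2 j) 1 - Pi.single runA 1 - Pi.single runB 1]
  b := 0

def maxFinish : AffineLayer (m + 2) (m + 2) where
  W := fun i => if i = runA then -Pi.single runA 1 - Pi.single runB 1 else 0
  b := Pi.single runA 1

def maxLast (o : Fin e) : AffineLayer (m + 2) e where
  W := fun i => if i = o then Pi.single runA 1 else 0
  b := 0

/-- The network that computes `relu (1 - max_j (ℓ_j · h))` in the coordinate `o`. -/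
def maxFFN (ℓ : Fin m → Fin e → ℝ) (o : Fin e) : FeedForward e (m + 2) :=
  .deep (maxFirst ℓ) ((List.finRange m).map maxStep ++ [maxFinish]) (maxLast o)

theorem maxFFN_depth (ℓ : Fin m → Fin e → ℝ) (o : Fin e) : (maxFFN ℓ o).depth = m + 3 := by
  simp [maxFFN, FeedForward.depth]

theorem foldl_maxStep {a : Fin m → ℝ} (ha : ∀ i, 0 ≤ a i) (js : List (Fin m))
    (z : Fin (m + 2) → ℝ) (u : ℝ) (hz : ∀ i, z (Fin.castAdd 2 i) = a i)
    (hu : z runA + z runB = u) (hu0 : 0 ≤ u) :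
    ∃ v, ((js.map maxStep).foldl (fun z A => A.evalRelu z) z) runA +
        ((js.map maxStep).foldl (fun z A => A.evalRelu z) z) runB = v ∧
      u ≤ v ∧ (∀ j ∈ js, a j ≤ v) ∧ (v = u ∨ ∃ j, v = a j) := by
  induction js generalizing z u with
  | nil => exact ⟨u, hu, le_rfl, by simp, Or.inl rfl⟩
  | cons j js ih =>
    have h1 : ∀ i, (maxStep j).evalRelu z (Fin.castAdd 2 i) = a i := by
      intro i
      rw [AffineLayer.evalRelu_apply]
      simp [maxStep, hz, relu_of_nonneg (ha i)]
    have h2 : (maxStep j).evalRelu z runA = u := by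
      rw [AffineLayer.evalRelu_apply]
      simp [maxStep, add_dotProduct, hu, relu_of_nonneg hu0]
    have h3 : (maxStep j).evalRelu z runB = relu (a j - u) := by
      rw [AffineLayer.evalRelu_apply]
      simp only [maxStep, Fin.addCases_right, Matrix.cons_val_one, Matrix.cons_val_zero,
        sub_dotProduct, single_dotProduct, one_mul, hz, Pi.zero_apply, add_zero]
      rw [← hu]; congr 1; ring
    have h4 : u + relu (a j - u) = max u (a j) := by
      rw [relu, ← max_add_add_left]; simp
    obtain ⟨v, hv, hle, hmem, hor⟩ := ih ((maxStep j).evalRelu z) (max u (a j)) h1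
      (by rw [h2, h3, h4]) (hu0.trans (le_max_left _ _))
    refine ⟨v, hv, (le_max_left _ _).trans hle, ?_, ?_⟩
    · intro i hi
      rcases List.mem_cons.1 hi with rfl | hi
      · exact (le_max_right _ _).trans hle
      · exact hmem i hi
    · rcases hor with h | h
      · rcases max_choice u (a j) with h5 | h5
        · exact Or.inl (h.trans h5)
        · exact Or.inr ⟨j, h.trans h5⟩
      · exact Or.inr h

/-- The first layer replaces each form by its positive part. This does not change the maximum when
one of the forms vanishes. -/
theorem maxFFN_eval (ℓ : Fin m → Fin e → ℝ) (o : Fin e) (h : Fin e → ℝ)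
    (h0 : ∃ j, ℓ j ⬝ᵥ h = 0) :
    ∃ v, IsGreatest (Set.range fun j => ℓ j ⬝ᵥ h) v ∧
      (maxFFN ℓ o).eval h = Pi.single o (relu (1 - v)) := by
  set a : Fin m → ℝ := fun j => relu (ℓ j ⬝ᵥ h) with ha
  have h1 : ∀ i, (maxFirst ℓ).evalRelu h (Fin.castAdd 2 i) = a i := by
    intro i
    rw [AffineLayer.evalRelu_apply]
    simp [maxFirst, ha]
  have h2 : ∀ i, (maxFirst ℓ).evalRelu h (Fin.natAdd m i) = 0 := by
    intro i
    rw [AffineLayer.evalRelu_apply]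
    simp [maxFirst, relu]
  obtain ⟨v, hv, hv0, hle, hor⟩ := foldl_maxStep (fun i => relu_nonneg (ℓ i ⬝ᵥ h))
    (List.finRange m) ((maxFirst ℓ).evalRelu h) 0 h1 (by rw [h2, h2, add_zero]) le_rfl
  obtain ⟨j0, hj0⟩ := h0
  refine ⟨v, ⟨?_, ?_⟩, ?_⟩
  · rcases hor with h3 | ⟨j, hj⟩
    · exact ⟨j0, hj0.trans h3.symm⟩
    · rcases le_or_gt 0 (ℓ j ⬝ᵥ h) with h4 | h4
      · exact ⟨j, by rw [hj, relu_of_nonneg h4]⟩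
      · exact ⟨j0, by simp only [hj0, hj]; rw [relu, max_eq_left h4.le]⟩
  · rintro _ ⟨j, rfl⟩
    exact (le_relu _).trans (hle j (List.mem_finRange j))
  · funext i
    simp only [maxFFN, FeedForward.eval, List.foldl_append, List.foldl_cons, List.foldl_nil]
    rw [AffineLayer.eval_apply]
    by_cases hi : i = o
    · subst hi
      simp only [maxLast, if_true, single_dotProduct, one_mul, Pi.zero_apply, add_zero,
        Pi.single_eq_same]
      rw [AffineLayer.evalRelu_apply]
      simp only [maxFinish, if_true, sub_dotProduct, neg_dotProduct, single_dotProduct, one_mul,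
        Pi.single_eq_same]
      congr 1
      linarith
    · simp [maxLast, hi]

theorem maxFFN_bounded {ℓ : Fin m → Fin e → ℝ} (o : Fin e) {κ : ℝ} (hκ : 3 ≤ κ)
    (hℓ : ∀ j a, |ℓ j a| ≤ κ) : (maxFFN ℓ o).Bounded κ := by
  have hs : ∀ {p : ℕ} (a i : Fin p), |(Pi.single a (1 : ℝ) : Fin p → ℝ) i| ≤ 1 := fun a i =>
    (abs_single_le a i 1).trans (by simp)
  have hκ0 : (0 : ℝ) ≤ κ := by linarith
  refine ⟨⟨fun i a => ?_, fun i => by simpa [maxFirst] using hκ0⟩, ?_, fun i a => ?_,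
    fun i => by simpa [maxLast] using hκ0⟩
  · induction i using Fin.addCases with
    | left i => simpa [maxFirst] using hℓ i a
    | right i => simpa [maxFirst] using hκ0
  · intro A hA
    rcases List.mem_append.1 hA with hA | hA
    · obtain ⟨j, -, rfl⟩ := List.mem_map.1 hA
      refine ⟨fun i a => ?_, fun i => by simpa [maxStep] using hκ0⟩
      induction i using Fin.addCases with
      | left i => simpa [maxStep] using (hs _ a).trans (by linarith : (1 : ℝ) ≤ κ)
      | right i =>
        have b1 := abs_le.1 (hs (runA (m := m)) a)
        have b2 := abs_le.1 (hs (runB (m := m)) a)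
        have b3 := abs_le.1 (hs (Fin.castAdd 2 j) a)
        fin_cases i
        · simp only [maxStep, Fin.addCases_right, Fin.zero_eta, Matrix.cons_val_zero,
            Pi.add_apply]
          rw [abs_le]; constructor <;> linarith
        · simp only [maxStep, Fin.addCases_right, Fin.mk_one, Matrix.cons_val_one,
            Matrix.cons_val_zero, Pi.sub_apply]
          rw [abs_le]; constructor <;> linarith
    · rw [List.mem_singleton.1 hA]
      refine ⟨fun i a => ?_, fun i => (hs _ i).trans (by linarith)⟩
      have b1 := abs_le.1 (hs (runA (m := m)) a)
      have b2 := abs_le.1 (hs (runB (m := m)) a)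
      by_cases hi : i = runA
      · simp only [maxFinish, hi, if_true, Pi.sub_apply, Pi.neg_apply]
        rw [abs_le]; constructor <;> linarith
      · simpa [maxFinish, hi] using hκ0
  · by_cases hi : i = o
    · simp only [maxLast, hi, if_true]
      exact (hs _ a).trans (by linarith)
    · simpa [maxLast, hi] using hκ0

end MaxNetwork

/-! #### Attention heads that read one token -/

section Selector

variable {e l : ℕ}

/-- The head that adds `c` times the entry `a` of the token at position `s₀` to the entry `b` of
each token, if the entries `r₀`, `r₁`, `r₂` of the token at position `s` are `1`, `s`, `s ^ 2`. -/
def selectorHead (r₀ r₁ r₂ a b : Fin e) (s₀ : ℕ) (c : ℝ) : Head e where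
  Q := fun i => if i = r₀ then Pi.single r₀ 1 else 0
  K := fun i => if i = r₀ then
    (Pi.single r₀ (1 - (s₀ : ℝ) ^ 2) : Fin e → ℝ) + (Pi.single r₁ (2 * (s₀ : ℝ)) : Fin e → ℝ) +
      (Pi.single r₂ (-1) : Fin e → ℝ) else 0
  V := fun i => if i = b then Pi.single a c else 0

theorem relu_one_sub_sq (s t : ℕ) :
    relu (1 - ((s : ℝ) - t) ^ 2) = if s = t then 1 else 0 := by
  split_ifs with h
  · simp [h, relu]
  · refine max_eq_left ?_
    have h1 : (1 : ℤ) ≤ |(s : ℤ) - t| := Int.one_le_abs (by omega)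
    have h2 : (1 : ℝ) ≤ |(s : ℝ) - t| := by exact_mod_cast h1
    rw [← sq_abs]
    nlinarith

/-- The key of position `s` is `(1 - s₀ ^ 2) + 2 * s₀ * s - s ^ 2 = 1 - (s - s₀) ^ 2`, linear in the
entries `1, s, s ^ 2`, and the query is `1`. After the ReLU the score is `1` at `s₀` and `0` at
every other integer. -/
theorem selectorHead_attn (r₀ r₁ r₂ a b : Fin e) (s₀ : Fin l) (c : ℝ)
    {X : Matrix (Fin e) (Fin l) ℝ} (h₀ : ∀ t, X r₀ t = 1) (h₁ : ∀ t, X r₁ t = (t : ℕ))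
    (h₂ : ∀ t, X r₂ t = ((t : ℕ) : ℝ) ^ 2) (i : Fin e) (t : Fin l) :
    (selectorHead r₀ r₁ r₂ a b s₀ c).attn X i t = if i = b then c * X a s₀ else 0 := by
  set A := selectorHead r₀ r₁ r₂ a b s₀ c with hA
  have hK : ∀ r s, (A.K * X) r s = if r = r₀ then 1 - ((s : ℕ) - (s₀ : ℕ) : ℝ) ^ 2 else 0 := by
    intro r s
    change A.K r ⬝ᵥ (fun j => X j s) = _
    by_cases hr : r = r₀
    · simp only [hA, selectorHead, hr, if_true, add_dotProduct, single_dotProduct, h₀, h₁, h₂]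
      ring
    · simp [hA, selectorHead, hr]
  have hQ : ∀ r s, (A.Q * X) r s = if r = r₀ then 1 else 0 := by
    intro r s
    change A.Q r ⬝ᵥ (fun j => X j s) = _
    by_cases hr : r = r₀
    · simp [hA, selectorHead, hr, h₀]
    · simp [hA, selectorHead, hr]
  have hV : ∀ r s, (A.V * X) r s = if r = b then c * X a s else 0 := by
    intro r s
    change A.V r ⬝ᵥ (fun j => X j s) = _
    by_cases hr : r = b
    · simp [hA, selectorHead, hr]
    · simp [hA, selectorHead, hr]
  have hS : ∀ s, (((A.K * X)ᵀ * (A.Q * X)).map relu) s t = if s = s₀ then 1 else 0 := by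
    intro s
    rw [Matrix.map_apply, Matrix.mul_apply]
    simp only [Matrix.transpose_apply, hK, hQ, mul_ite, mul_one, mul_zero]
    rw [Finset.sum_eq_single r₀ (by intro r _ hr; simp [hr]) (by simp)]
    simp only [if_true]
    rw [relu_one_sub_sq]
    simp [Fin.ext_iff]
  rw [Head.attn, Matrix.mul_apply]
  simp only [hV, hS, mul_ite, mul_one, mul_zero]
  simp

/-- The weight `1 - s₀ ^ 2` is the reason that `κ` grows with the square of the number of tokens. -/
theorem selectorHead_bounded (r₀ r₁ r₂ a b : Fin e) {s₀ l : ℕ} (hs : s₀ < l) {c κ : ℝ}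
    (hκ : 5 * (l : ℝ) ^ 2 ≤ κ) (hc : |c| ≤ κ) :
    (selectorHead r₀ r₁ r₂ a b s₀ c).Bounded κ := by
  have hl : (1 : ℝ) ≤ l := by exact_mod_cast Nat.one_le_of_lt hs
  have hsl : (s₀ : ℝ) ≤ l := by exact_mod_cast hs.le
  have hs0 : (0 : ℝ) ≤ s₀ := Nat.cast_nonneg _
  have hκ1 : 5 ≤ κ := by nlinarith
  refine ⟨fun i j => ?_, fun i j => ?_, fun i j => ?_⟩
  · by_cases hi : i = r₀
    · simp only [selectorHead, hi, if_true]
      exact (abs_single_le _ _ _).trans (by simp; linarith)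
    · simp only [selectorHead, hi, if_false, Pi.zero_apply, abs_zero]; linarith
  · by_cases hi : i = r₀
    · simp only [selectorHead, hi, if_true, Pi.add_apply]
      have b1 := abs_single_le r₀ j (1 - (s₀ : ℝ) ^ 2)
      have b2 := abs_single_le r₁ j (2 * (s₀ : ℝ))
      have b3 := abs_single_le r₂ j (-1)
      have c1 : |1 - (s₀ : ℝ) ^ 2| ≤ 1 + (l : ℝ) ^ 2 := by
        rw [abs_le]; constructor <;> nlinarith
      have c2 : |2 * (s₀ : ℝ)| ≤ 2 * (l : ℝ) := by rw [abs_of_nonneg (by positivity)]; linarith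
      have c3 : |(-1 : ℝ)| = 1 := by norm_num
      refine (abs_add_three _ _ _).trans ?_
      nlinarith
    · simp only [selectorHead, hi, if_false, Pi.zero_apply, abs_zero]; linarith
  · by_cases hi : i = b
    · simp only [selectorHead, hi, if_true]
      exact (abs_single_le _ _ _).trans hc
    · simp only [selectorHead, hi, if_false, Pi.zero_apply, abs_zero]; linarith

/-- The output matrix that adds the outputs of all heads. -/
def sumHeads (h e : ℕ) : Matrix (Fin e) (Fin h × Fin e) ℝ :=
  fun i p => if i = p.2 then 1 else 0

theorem mha_sumHeads {w h : ℕ} (A : Fin h → Head e) (F : FeedForward e w)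
    (X : Matrix (Fin e) (Fin l) ℝ) (i : Fin e) (t : Fin l) :
    (Block.mk h A (sumHeads h e) F).mha X i t = ∑ j, (A j).attn X i t := by
  rw [Block.mha, Matrix.mul_apply, Fintype.sum_prod_type]
  refine Finset.sum_congr rfl fun j _ => ?_
  simp [sumHeads]

theorem sumHeads_abs_le {h : ℕ} {κ : ℝ} (hκ : 1 ≤ κ) (i : Fin e) (p : Fin h × Fin e) :
    |sumHeads h e i p| ≤ κ := by
  by_cases hi : i = p.2
  · simpa [sumHeads, hi] using hκ
  · simp only [sumHeads, hi, if_false, abs_zero]; linarith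

end Selector

/-! #### The transformer -/

section Transformer

variable {D n : ℕ}

/-- The entries of a token that do not hold a point of `ℝ^D`: the output, the raw input, the
constant `1`, the position, its square, and the value of a nodal function. -/
abbrev slot (i : Fin 6) : Fin (6 + D) := Fin.castAdd D i

/-- The entries of a token that hold a point of `ℝ^D`. -/
abbrev coordSlot (i : Fin D) : Fin (6 + D) := Fin.natAdd 6 i

/-- The first `D` tokens receive the coordinates of the input, the next `n` belong to the lattice
points, and the one left over at the end is read by the decoder. -/
abbrev coordToken (i : Fin D) : Fin (D + n + 1) := ⟨i, by omega⟩

abbrev cellToken (j : Fin n) : Fin (D + n + 1) := ⟨D + j, by omega⟩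

/-- The lattice point attached to a token. -/
def tokenCell (k : Fin n → Fin D → ℤ) (t : Fin (D + n + 1)) (i : Fin D) : ℝ :=
  if h : D ≤ t ∧ (t : ℕ) < D + n then k ⟨t - D, by omega⟩ i else 0

def cellInput (δ : ℝ) (k : Fin n → Fin D → ℤ) : InputStage D (6 + D) (D + n + 1) where
  U := fun t => if h : (t : ℕ) < D then Pi.single ⟨t, h⟩ δ⁻¹ else 0
  E' := Pi.single (slot 1) 1
  PE := fun r t => Fin.addCases (motive := fun _ => ℝ)
    ![0, 0, 1, (t : ℕ), ((t : ℕ) : ℝ) ^ 2, 0] (fun i => -tokenCell k t i) r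

/-- The number of pairs of vertices of the standard simplex. -/
abbrev pairCount (D : ℕ) : ℕ := (D + 1) ^ 2

theorem card_pairs (D : ℕ) : Fintype.card (Option (Fin D) × Option (Fin D)) = pairCount D := by
  simp [sq]

def pairAt (j : Fin (pairCount D)) : Option (Fin D) × Option (Fin D) :=
  (Fintype.equivFinOfCardEq (card_pairs D)).symm j

def coordForm (o : Option (Fin D)) : Fin (6 + D) → ℝ :=
  o.elim 0 fun i => Pi.single (coordSlot i) 1

/-- Head `i` broadcasts `x i / δ` to the coordinate slot `i` of every token. The residual connection
adds it to minus the lattice point stored there, and the feed-forward layer writes the nodal value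
to slot `5`. -/
def gatherBlock (D n : ℕ) : Block (6 + D) (pairCount D + 2) where
  heads := D
  head := fun i => selectorHead (slot 2) (slot 3) (slot 4) (slot 1) (coordSlot i)
    (coordToken (n := n) i : ℕ) 1
  WO := sumHeads D (6 + D)
  ffn := maxFFN (fun j => coordForm (pairAt j).1 - coordForm (pairAt j).2) (slot 5)

/-- Only the coefficients `c` depend on the function to be approximated. The feed-forward layer is
zero, so the sum formed by the attention passes through. -/
def readoutBlock (c : Fin n → ℝ) : Block (6 + D) (pairCount D + 2) where
  heads := n
  head := fun j => selectorHead (slot 2) (slot 3) (slot 4) (slot 5) (slot 0)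
    (cellToken (D := D) j : ℕ) (c j)
  WO := sumHeads n (6 + D)
  ffn := .single ⟨0, 0⟩

theorem slot_ne_coordSlot (r : Fin 6) (i : Fin D) : slot r ≠ coordSlot i := by
  intro h
  have := congrArg Fin.val h
  simp only [Fin.val_castAdd, Fin.val_natAdd] at this
  omega

theorem slot_inj {r s : Fin 6} : (slot r : Fin (6 + D)) = slot s ↔ r = s :=
  (Fin.castAdd_injective 6 D).eq_iff

theorem cellInput_eval_slot (δ : ℝ) (k : Fin n → Fin D → ℤ) (x : EuclideanSpace ℝ (Fin D))
    {r : Fin 6} (hr : r ≠ 1) (t : Fin (D + n + 1)) :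
    (cellInput δ k).eval x (slot r) t =
      (![0, 0, 1, (t : ℕ), ((t : ℕ) : ℝ) ^ 2, 0] : Fin 6 → ℝ) r := by
  have h : (slot r : Fin (6 + D)) ≠ slot 1 := fun h => hr (slot_inj.1 h)
  rw [InputStage.eval, Matrix.add_apply, Matrix.of_apply]
  simp [cellInput, Pi.single_eq_of_ne h]

theorem cellInput_eval_raw (δ : ℝ) (k : Fin n → Fin D → ℤ) (x : EuclideanSpace ℝ (Fin D))
    (i : Fin D) : (cellInput δ k).eval x (slot 1) (coordToken i) = x i / δ := by
  have h1 : ((cellInput δ k).U *ᵥ fun j => x j) (coordToken i) = x i / δ := by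
    change (cellInput δ k).U (coordToken i) ⬝ᵥ (fun j => x j) = _
    simp [cellInput, div_eq_inv_mul]
  rw [InputStage.eval, Matrix.add_apply, Matrix.of_apply, h1]
  simp [cellInput]

theorem cellInput_eval_coord (δ : ℝ) (k : Fin n → Fin D → ℤ) (x : EuclideanSpace ℝ (Fin D))
    (i : Fin D) (j : Fin n) :
    (cellInput δ k).eval x (coordSlot i) (cellToken j) = -(k j i : ℝ) := by
  have h : (coordSlot i : Fin (6 + D)) ≠ slot 1 := (slot_ne_coordSlot 1 i).symm
  rw [InputStage.eval, Matrix.add_apply, Matrix.of_apply]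
  simp [cellInput, Pi.single_eq_of_ne h, tokenCell]

theorem gatherBlock_mha (δ : ℝ) (k : Fin n → Fin D → ℤ) (x : EuclideanSpace ℝ (Fin D))
    (r : Fin (6 + D)) (t : Fin (D + n + 1)) :
    (gatherBlock D n).mha ((cellInput δ k).eval x) r t =
      ∑ i, if r = coordSlot i then x i / δ else 0 := by
  rw [gatherBlock, mha_sumHeads]
  refine Finset.sum_congr rfl fun i _ => ?_
  rw [selectorHead_attn]
  · rw [cellInput_eval_raw, one_mul]
  · intro t; rw [cellInput_eval_slot _ _ _ (by decide)]; rfl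
  · intro t; rw [cellInput_eval_slot _ _ _ (by decide)]; rfl
  · intro t; rw [cellInput_eval_slot _ _ _ (by decide)]; rfl

theorem coordForm_dotProduct (o : Option (Fin D)) (h : Fin (6 + D) → ℝ) :
    coordForm o ⬝ᵥ h = extendZero (fun i => h (coordSlot i)) o := by
  cases o <;> simp [coordForm, extendZero]

theorem gatherBlock_ffn_eval (h : Fin (6 + D) → ℝ) :
    (gatherBlock D n).ffn.eval h = Pi.single (slot 5) (kuhnHat fun i => h (coordSlot i)) := by
  have hform : ∀ j : Fin (pairCount D), (coordForm (pairAt j).1 - coordForm (pairAt j).2) ⬝ᵥ h =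
      extendZero (fun i => h (coordSlot i)) (pairAt j).1 -
        extendZero (fun i => h (coordSlot i)) (pairAt j).2 := by
    intro j
    rw [sub_dotProduct, coordForm_dotProduct, coordForm_dotProduct]
  -- The pair `(none, none)` gives the zero form, as the maximum network requires.
  obtain ⟨v, hv, hev⟩ := maxFFN_eval
    (fun j : Fin (pairCount D) => coordForm (pairAt j).1 - coordForm (pairAt j).2) (slot 5) h
    ⟨Fintype.equivFinOfCardEq (card_pairs D) (none, none), by rw [hform]; simp [pairAt]⟩
  rw [gatherBlock, hev]
  congr 1
  refine (kuhnHat_eq_relu ?_).symm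
  convert hv using 1
  simp only [hform]
  exact ((Fintype.equivFinOfCardEq (card_pairs D)).symm.surjective.range_comp
    (fun p : Option (Fin D) × Option (Fin D) => extendZero (fun i => h (coordSlot i)) p.1 -
        extendZero (fun i => h (coordSlot i)) p.2)).symm

theorem gatherBlock_eval_slot (δ : ℝ) (k : Fin n → Fin D → ℤ) (x : EuclideanSpace ℝ (Fin D))
    {r : Fin 6} (hr : r ≠ 1) (hr5 : r ≠ 5) (t : Fin (D + n + 1)) :
    (gatherBlock D n).eval ((cellInput δ k).eval x) (slot r) t =
      (![0, 0, 1, (t : ℕ), ((t : ℕ) : ℝ) ^ 2, 0] : Fin 6 → ℝ) r := by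
  have h : (slot r : Fin (6 + D)) ≠ slot 5 := fun h => hr5 (slot_inj.1 h)
  rw [Block.eval, Matrix.add_apply, Matrix.add_apply, gatherBlock_mha, cellInput_eval_slot _ _ _ hr,
    FeedForward.apply, Matrix.of_apply, gatherBlock_ffn_eval, Pi.single_eq_of_ne h]
  simp [slot_ne_coordSlot]

theorem gatherBlock_eval_hat (δ : ℝ) (k : Fin n → Fin D → ℤ) (x : EuclideanSpace ℝ (Fin D))
    (j : Fin n) :
    (gatherBlock D n).eval ((cellInput δ k).eval x) (slot 5) (cellToken j) =
      kuhnHat fun i => x i / δ - k j i := by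
  rw [Block.eval, Matrix.add_apply, Matrix.add_apply, gatherBlock_mha,
    cellInput_eval_slot _ _ _ (by decide), FeedForward.apply, Matrix.of_apply,
    gatherBlock_ffn_eval, Pi.single_eq_same]
  have h1 : (fun i : Fin D => ((gatherBlock D n).mha ((cellInput δ k).eval x) +
      (cellInput δ k).eval x) (coordSlot i) (cellToken j)) = fun i => x i / δ - k j i := by
    funext i
    rw [Matrix.add_apply, gatherBlock_mha, cellInput_eval_coord]
    simp [sub_eq_add_neg]
  rw [h1]
  simp [slot_ne_coordSlot]

/-- The two blocks compute a linear combination of nodal functions. -/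
theorem readoutBlock_eval (δ : ℝ) (k : Fin n → Fin D → ℤ) (c : Fin n → ℝ)
    (x : EuclideanSpace ℝ (Fin D)) (t : Fin (D + n + 1)) :
    (readoutBlock c).eval ((gatherBlock D n).eval ((cellInput δ k).eval x)) (slot 0) t =
      ∑ j, c j * kuhnHat fun i => x i / δ - k j i := by
  rw [Block.eval, Matrix.add_apply, Matrix.add_apply,
    gatherBlock_eval_slot _ _ _ (by decide) (by decide), FeedForward.apply, Matrix.of_apply,
    readoutBlock, mha_sumHeads]
  have h1 : ∀ j, (selectorHead (slot 2) (slot 3) (slot 4) (slot 5) (slot 0)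
      (cellToken (D := D) j : ℕ) (c j)).attn ((gatherBlock D n).eval ((cellInput δ k).eval x))
      (slot 0) t = c j * kuhnHat fun i => x i / δ - k j i := by
    intro j
    rw [selectorHead_attn, if_pos rfl, gatherBlock_eval_hat]
    · intro t; rw [gatherBlock_eval_slot _ _ _ (by decide) (by decide)]; rfl
    · intro t; rw [gatherBlock_eval_slot _ _ _ (by decide) (by decide)]; rfl
    · intro t; rw [gatherBlock_eval_slot _ _ _ (by decide) (by decide)]; rfl
  simp [h1, FeedForward.eval, AffineLayer.eval]

theorem gatherBlock_bounded {κ : ℝ} (hκ : 5 * ((D + n + 1 : ℕ) : ℝ) ^ 2 ≤ κ) :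
    (gatherBlock D n).Bounded κ := by
  have hl : (1 : ℝ) ≤ (D + n + 1 : ℕ) := by exact_mod_cast Nat.succ_pos _
  have hκ5 : 5 ≤ κ := by nlinarith
  refine ⟨fun i => selectorHead_bounded _ _ _ _ _ (coordToken i).2 hκ (by simp; linarith),
    fun i p => sumHeads_abs_le (by linarith) i p, maxFFN_bounded _ (by linarith) fun j a => ?_⟩
  have h1 : ∀ o : Option (Fin D), |coordForm o a| ≤ 1 := by
    intro o
    cases o with
    | none => simp [coordForm]
    | some i => exact (abs_single_le _ _ _).trans (by simp)
  have b1 := abs_le.1 (h1 (pairAt j).1)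
  have b2 := abs_le.1 (h1 (pairAt j).2)
  rw [Pi.sub_apply, abs_le]
  constructor <;> linarith

theorem readoutBlock_bounded {κ : ℝ} (hκ : 5 * ((D + n + 1 : ℕ) : ℝ) ^ 2 ≤ κ) {c : Fin n → ℝ}
    (hc : ∀ j, |c j| ≤ κ) : (readoutBlock (D := D) c).Bounded κ := by
  have hl : (1 : ℝ) ≤ (D + n + 1 : ℕ) := by exact_mod_cast Nat.succ_pos _
  have hκ5 : 5 ≤ κ := by nlinarith
  refine ⟨fun j => selectorHead_bounded _ _ _ _ _ (cellToken j).2 hκ (hc j),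
    fun i p => sumHeads_abs_le (by linarith) i p, fun i a => ?_, fun i => ?_⟩ <;>
  · change |(0 : ℝ)| ≤ κ
    rw [abs_zero]; linarith

theorem cellInput_bounded {δ κ : ℝ} {k : Fin n → Fin D → ℤ}
    (hκ : 5 * ((D + n + 1 : ℕ) : ℝ) ^ 2 ≤ κ) (hδ : |δ⁻¹| ≤ κ) (hk : ∀ j i, |(k j i : ℝ)| ≤ κ) :
    (cellInput δ k).Bounded κ := by
  have hl : (1 : ℝ) ≤ (D + n + 1 : ℕ) := by exact_mod_cast Nat.succ_pos _
  have hκ5 : 5 ≤ κ := by nlinarith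
  refine ⟨fun t i => ?_, fun r => (abs_single_le _ _ _).trans (by simp; linarith), fun r t => ?_⟩
  · by_cases h : (t : ℕ) < D
    · simp only [cellInput, h, dite_true]
      exact (abs_single_le _ _ _).trans hδ
    · simp only [cellInput, h, dite_false, Pi.zero_apply, abs_zero]; linarith
  · have ht : ((t : ℕ) : ℝ) ≤ (D + n + 1 : ℕ) := by exact_mod_cast t.2.le
    have ht0 : (0 : ℝ) ≤ (t : ℕ) := Nat.cast_nonneg _
    induction r using Fin.addCases with
    | left r =>
      simp only [cellInput, Fin.addCases_left]
      fin_cases r <;> simp only [Fin.zero_eta, Fin.mk_one, Fin.reduceFinMk, Matrix.cons_val,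
        abs_zero, abs_one, Nat.abs_cast, abs_pow] <;> nlinarith
    | right i =>
      simp only [cellInput, Fin.addCases_right, abs_neg, tokenCell]
      split_ifs with h
      · exact hk _ _
      · rw [abs_zero]; linarith

/-- The parameters of the two-block transformers above. -/
def cellParams (D n : ℕ) (R κ : ℝ) : Params where
  LT := 2
  Lff := pairCount D + 3
  wff := pairCount D + 2
  l := D + n + 1
  dembd := 6 + D
  m := D + n
  R := R
  κ := κ
  l_pos := by omega
  dembd_pos := by omega

/-- The bound `R` holds on all of `ℝ^D` since the output is a combination of values in `[-R, R]`
with nonnegative weights of sum at most `1`. -/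
theorem exists_mem_transformerClass {δ R κ : ℝ} {k : Fin n → Fin D → ℤ}
    (hκ : 5 * ((D + n + 1 : ℕ) : ℝ) ^ 2 ≤ κ) (hδ : |δ⁻¹| ≤ κ) (hk : ∀ j i, |(k j i : ℝ)| ≤ κ)
    (hR : R ≤ κ) (hR0 : 0 ≤ R)
    (hsum : ∀ x : EuclideanSpace ℝ (Fin D), ∑ j, kuhnHat (fun i => x i / δ - k j i) ≤ 1)
    {c : Fin n → ℝ} (hc : ∀ j, |c j| ≤ R) :
    (fun x : EuclideanSpace ℝ (Fin D) => ∑ j, c j * kuhnHat fun i => x i / δ - k j i) ∈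
      transformerClass (cellParams D n R κ) (cellInput δ k) := by
  refine ⟨[gatherBlock D n, readoutBlock c], rfl, ?_, cellInput_bounded hκ hδ hk, ?_, ?_⟩
  · intro B hB
    rcases List.mem_cons.1 hB with rfl | hB
    · exact ⟨Nat.le_add_right _ _, (maxFFN_depth _ _).le, gatherBlock_bounded hκ⟩
    · obtain rfl := List.mem_singleton.1 hB
      refine ⟨Nat.le_add_left _ _, ?_, readoutBlock_bounded hκ fun j => (hc j).trans hR⟩
      change 1 ≤ pairCount D + 3
      omega
  · funext x
    exact (readoutBlock_eval δ k c x _).symm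
  · intro x
    calc |∑ j, c j * kuhnHat fun i => x i / δ - k j i|
        ≤ ∑ j, |c j * kuhnHat fun i => x i / δ - k j i| := Finset.abs_sum_le_sum_abs _ _
      _ ≤ ∑ j, R * kuhnHat fun i => x i / δ - k j i := by
          refine Finset.sum_le_sum fun j _ => ?_
          rw [abs_mul, abs_of_nonneg (kuhnHat_nonneg _)]
          exact mul_le_mul_of_nonneg_right (hc j) (kuhnHat_nonneg _)
      _ = R * ∑ j, kuhnHat fun i => x i / δ - k j i := by rw [Finset.mul_sum]
      _ ≤ R * 1 := by gcongr; exact hsum x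
      _ = R := mul_one R

end Transformer

end TransformerApprox

end Network

/-! ### Approximation of Hölder functions on submanifolds -/

section Approximation

namespace TransformerApprox

variable {D : ℕ}

theorem abs_cellIndex_le {δ M : ℝ} (hδ : 0 < δ) {x : EuclideanSpace ℝ (Fin D)}
    (hx : ∀ i, |x i| ≤ M) {s : ℝ} (hs : s ∈ Set.Ico (0 : ℝ) 1) (i : Fin D) :
    |(cellIndex δ x s i : ℝ)| ≤ M / δ + 2 := by
  have h1 : |x i / δ| ≤ M / δ := by
    rw [abs_div, abs_of_pos hδ]
    gcongr
    exact hx i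
  have h2 := abs_le.1 h1
  have h3 := Int.floor_le (x i / δ + s)
  have h4 := Int.lt_floor_add_one (x i / δ + s)
  rw [cellIndex, abs_le]
  constructor <;> linarith [hs.1, hs.2]

theorem dist_le_of_cellIndex_eq {δ : ℝ} (hδ : 0 < δ) {x y : EuclideanSpace ℝ (Fin D)} {s t : ℝ}
    (hs : s ∈ Set.Ico (0 : ℝ) 1) (ht : t ∈ Set.Ico (0 : ℝ) 1)
    (h : cellIndex δ x s = cellIndex δ y t) : dist x y ≤ (D + 1) * (2 * δ) := by
  rw [dist_eq_norm]
  refine norm_le_of_abs_le (by positivity) fun i => ?_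
  have h1 := abs_lt.1 (abs_sub_lt_of_floor_eq (congrFun h i))
  have h2 : (x - y) i = (x i / δ - y i / δ) * δ := by rw [PiLp.sub_apply]; field_simp
  have h3 : |x i / δ - y i / δ| ≤ 2 := by
    rw [abs_le]
    constructor <;> linarith [hs.1, hs.2, ht.1, ht.2]
  rw [h2, abs_mul, abs_of_pos hδ]
  gcongr

/-- The number of lattice cells of size `δ` that meet a `d`-dimensional submanifold has the order
`δ ^ (-d)`. -/
theorem exists_cells_of_isSmoothSubmanifold {N d : ℕ} {τ : ℝ} (hτ : 0 < τ)
    {𝓜 : Set (EuclideanSpace ℝ (Fin D))} (hK : IsCompact 𝓜) (hM : IsSmoothSubmanifold d 𝓜)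
    (hreach : ENNReal.ofReal τ ≤ reach 𝓜) (hN : HasChartCover τ N 𝓜)
    {c q : ℝ} (hc : 0 < c) (hq : 0 < q) (hq1 : q ≤ 1) :
    ∃ Λ : Finset (Fin D → ℤ),
      (Λ.card : ℝ) ≤ N * (100 * (D + 1) + 2) ^ D * (τ * (D + 1) / (50 * c) + 2) ^ D * 4 ^ D *
        (q⁻¹) ^ d ∧
      ∀ k, k ∈ Λ ↔ ∃ x ∈ 𝓜, ∃ s ∈ Set.Ico (0 : ℝ) 1, cellIndex (c * q) x s = k := by
  -- A point of `𝓜` is needed for `d ≤ D`, which makes the constants independent of `d`.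
  rcases 𝓜.eq_empty_or_nonempty with rfl | ⟨p, hp⟩
  · exact ⟨∅, by simp; positivity, by simp⟩
  obtain ⟨T, hT, hTd⟩ := hM.exists_regularTangents
  have hdD : d ≤ D := by
    rw [← hTd p hp]
    simpa using (T p).finrank_le
  have hdD' : (d : ℝ) ≤ D := by exact_mod_cast hdD
  obtain ⟨Λ, hΛ, hmem⟩ := (hT.smallCover hK (uniqueNearest_of_le_reach hreach) hτ hTd hN
    (mul_pos hc hq)).exists_cells (mul_pos hc hq)
  refine ⟨Λ, hΛ.trans ?_, hmem⟩
  have hq2 : 1 ≤ q⁻¹ := (one_le_inv₀ hq).2 hq1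
  have h1 : (τ * (d + 1) / (50 * (c * q)) + 2) ^ d ≤
      (τ * (D + 1) / (50 * c) + 2) ^ D * (q⁻¹) ^ d := by
    calc (τ * (d + 1) / (50 * (c * q)) + 2) ^ d
        ≤ ((τ * (D + 1) / (50 * c) + 2) * q⁻¹) ^ d := by
          gcongr
          rw [add_mul]
          have e1 : τ * (D + 1) / (50 * c) * q⁻¹ = τ * (D + 1) / (50 * (c * q)) := by
            field_simp
          rw [e1]
          have e2 : τ * (d + 1) / (50 * (c * q)) ≤ τ * (D + 1) / (50 * (c * q)) := by gcongr
          linarith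
      _ = (τ * (D + 1) / (50 * c) + 2) ^ d * (q⁻¹) ^ d := mul_pow _ _ _
      _ ≤ _ := by
          have h2 : (1 : ℝ) ≤ τ * (D + 1) / (50 * c) + 2 := by
            have : 0 ≤ τ * (D + 1) / (50 * c) := by positivity
            linarith
          gcongr
  calc (N : ℝ) * ((100 * (D + 1) + 2) ^ D * (τ * (d + 1) / (50 * (c * q)) + 2) ^ d) * 4 ^ D
      ≤ N * ((100 * (D + 1) + 2) ^ D * ((τ * (D + 1) / (50 * c) + 2) ^ D * (q⁻¹) ^ d)) *
        4 ^ D := by gcongr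
    _ = _ := by ring

/-- Interpolation at the lattice by nodal functions is accurate on `𝓜`. -/
theorem abs_sum_kuhnHat_sub_le {δ η : ℝ} (hδ : 0 < δ) {𝓜 : Set (EuclideanSpace ℝ (Fin D))}
    {f : 𝓜 → ℝ} (hf : ∀ x y : 𝓜, dist x y ≤ (D + 1) * (2 * δ) → |f x - f y| ≤ η)
    {Λ : Finset (Fin D → ℤ)}
    (hΛ : ∀ k, k ∈ Λ ↔ ∃ x ∈ 𝓜, ∃ s ∈ Set.Ico (0 : ℝ) 1, cellIndex δ x s = k)
    {v : (Fin D → ℤ) → ℝ} (hv : ∀ k ∈ Λ, ∃ y : 𝓜, v k = f y ∧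
      ∃ s ∈ Set.Ico (0 : ℝ) 1, cellIndex δ y s = k) (x : 𝓜) :
    |∑ k ∈ Λ, v k * kuhnHat (fun i => (x : EuclideanSpace ℝ (Fin D)) i / δ - k i) - f x| ≤ η := by
  have hone : ∑ k ∈ Λ, kuhnHat (fun i => (x : EuclideanSpace ℝ (Fin D)) i / δ - k i) = 1 :=
    sum_kuhnHat_eq_one fun s hs => (hΛ _).2 ⟨x, x.2, s, hs, rfl⟩
  have h1 : ∑ k ∈ Λ, v k * kuhnHat (fun i => (x : EuclideanSpace ℝ (Fin D)) i / δ - k i) - f x =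
      ∑ k ∈ Λ, (v k - f x) * kuhnHat (fun i => (x : EuclideanSpace ℝ (Fin D)) i / δ - k i) := by
    simp only [sub_mul, Finset.sum_sub_distrib, ← Finset.mul_sum, hone, mul_one]
  rw [h1]
  calc _ ≤ ∑ k ∈ Λ, |(v k - f x) *
        kuhnHat (fun i => (x : EuclideanSpace ℝ (Fin D)) i / δ - k i)| :=
        Finset.abs_sum_le_sum_abs _ _
    _ ≤ ∑ k ∈ Λ, η * kuhnHat (fun i => (x : EuclideanSpace ℝ (Fin D)) i / δ - k i) := by
        refine Finset.sum_le_sum fun k hk => ?_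
        rw [abs_mul, abs_of_nonneg (kuhnHat_nonneg _)]
        by_cases h0 : kuhnHat (fun i => (x : EuclideanSpace ℝ (Fin D)) i / δ - k i) = 0
        · simp [h0]
        -- An active node means that some shift puts `x` itself into the cell, next to the sample
        -- point `y`.
        · obtain ⟨s, hs, hsk⟩ := exists_shift_of_kuhnHat_ne_zero h0
          obtain ⟨y, hy, t, ht, htk⟩ := hv k hk
          refine mul_le_mul_of_nonneg_right ?_ (kuhnHat_nonneg _)
          rw [hy]
          exact hf y x (dist_le_of_cellIndex_eq hδ ht hs (htk.trans hsk.symm))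
    _ = η := by rw [← Finset.mul_sum, hone, mul_one]

/-- The input stage stores only the lattice points, so it is chosen before `f`; the samples of `f`
enter as readout coefficients. -/
theorem exists_transformerClass_of_cells {δ η R M κ : ℝ} (hδ : 0 < δ) (hR : 0 ≤ R)
    {𝓜 : Set (EuclideanSpace ℝ (Fin D))} (hM : ∀ x ∈ 𝓜, ∀ i, |x i| ≤ M)
    {Λ : Finset (Fin D → ℤ)}
    (hΛ : ∀ k, k ∈ Λ ↔ ∃ x ∈ 𝓜, ∃ s ∈ Set.Ico (0 : ℝ) 1, cellIndex δ x s = k)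
    (hκ : 5 * ((D + Λ.card + 1 : ℕ) : ℝ) ^ 2 ≤ κ) (hκδ : δ⁻¹ ≤ κ) (hκM : M / δ + 2 ≤ κ)
    (hκR : R ≤ κ) :
    ∃ S : InputStage D (6 + D) (D + Λ.card + 1), ∀ f : 𝓜 → ℝ,
      (∀ x y : 𝓜, dist x y ≤ (D + 1) * (2 * δ) → |f x - f y| ≤ η) → (∀ x, |f x| ≤ R) →
      ∃ T ∈ transformerClass (cellParams D Λ.card R κ) S, ∀ x : 𝓜, |T x - f x| ≤ η := by
  let k : Fin Λ.card → Fin D → ℤ := fun j => (Λ.equivFin.symm j : Fin D → ℤ)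
  have hkΛ : ∀ j, k j ∈ Λ := fun j => (Λ.equivFin.symm j).2
  have hsum : ∀ g : (Fin D → ℤ) → ℝ, ∑ j, g (k j) = ∑ a ∈ Λ, g a := fun g => by
    rw [← Finset.sum_coe_sort Λ g]
    exact Equiv.sum_comp Λ.equivFin.symm fun a : Λ => g a
  refine ⟨cellInput δ k, fun f hf hfR => ?_⟩
  have hv : ∀ a, ∃ v : ℝ, |v| ≤ R ∧ (a ∈ Λ → ∃ y : 𝓜, v = f y ∧
      ∃ s ∈ Set.Ico (0 : ℝ) 1, cellIndex δ y s = a) := by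
    intro a
    by_cases ha : a ∈ Λ
    · obtain ⟨y, hy, s, hs, hsa⟩ := (hΛ a).1 ha
      exact ⟨f ⟨y, hy⟩, hfR _, fun _ => ⟨⟨y, hy⟩, rfl, s, hs, hsa⟩⟩
    · exact ⟨0, by simpa using hR, fun h => absurd h ha⟩
  choose v hvR hv using hv
  refine ⟨_, exists_mem_transformerClass (c := fun j => v (k j)) hκ ?_ ?_ hκR hR ?_
    fun j => hvR _, fun x => ?_⟩
  · rwa [abs_of_pos (inv_pos.2 hδ)]
  · intro j i
    obtain ⟨y, hy, s, hs, hsk⟩ := (hΛ _).1 (hkΛ j)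
    rw [← hsk]
    exact (abs_cellIndex_le hδ (hM y hy) hs i).trans hκM
  · intro x
    rw [hsum fun a => kuhnHat fun i => x i / δ - a i]
    exact sum_kuhnHat_le_one δ x Λ
  · rw [hsum fun a => v a * kuhnHat fun i => (x : EuclideanSpace ℝ (Fin D)) i / δ - a i]
    exact abs_sum_kuhnHat_sub_le hδ hf hΛ hv x

end TransformerApprox

end Approximation

/-! ### The theorem: choice of the constants -/

theorem theorem2 (N D : ℕ) (H τ β : ℝ) (hH : 0 < H) (hτ : 0 < τ) (hβ : 0 < β) (hβ1 : β ≤ 1) :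
    ∃ C : ℝ, ∀ M R : ℝ, 0 < M → 0 < R → ∃ Cκ : ℝ,
      ∀ d : ℕ, 1 ≤ d →
      ∀ 𝓜 : Set (EuclideanSpace ℝ (Fin D)),
        IsCompact 𝓜 → TransformerApprox.IsSmoothSubmanifold d 𝓜 →
        (∀ x ∈ 𝓜, ∀ i, |x i| ≤ M) →
        ENNReal.ofReal τ ≤ TransformerApprox.reach 𝓜 →
        TransformerApprox.HasChartCover τ N 𝓜 →
      ∀ ε : ℝ, 0 < ε → ε < 1 →
      ∃ (P : TransformerApprox.Params) (S : TransformerApprox.InputStage D P.dembd P.l),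
        (P.LT : ℝ) ≤ C * (1 + Real.log d) ∧
        (P.Lff : ℝ) ≤ C * (1 + Real.log ε⁻¹) ∧
        (P.wff : ℝ) ≤ C ∧
        (P.l : ℝ) ≤ C * (d * ε ^ (-(d : ℝ) / β)) ∧
        (P.dembd : ℝ) ≤ C ∧
        (P.m : ℝ) ≤ C * (d * ε ^ (-(d : ℝ) / β)) ∧
        P.κ ≤ Cκ * ((d : ℝ) ^ 2 * ε ^ (-(2 * (d : ℝ)) / β)) ∧
        P.R = R ∧
        ∀ f : 𝓜 → ℝ, TransformerApprox.IsHolder H β f → (∀ x, |f x| ≤ R) →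
          ∃ T ∈ TransformerApprox.transformerClass P S, ∀ x : 𝓜, |T x - f x| ≤ ε := by
  open TransformerApprox in
  -- With spacing `c * ε ^ (1 / β)`, a node and its point are within `r = (D + 1) * (2 * c) * ε ^ (1
  -- / β)`. The first condition puts `r` in the range of the local geodesic comparison, the second
  -- makes the oscillation `H * (2 * r) ^ β` at most `ε`.
  obtain ⟨c, hc, hcτ, hcH⟩ : ∃ c : ℝ, 0 < c ∧ (D + 1) * (2 * c) ≤ τ / 400 ∧
      H * (2 * ((D + 1) * (2 * c))) ^ β ≤ 1 := by
    set a : ℝ := min (τ / 400) (H⁻¹ ^ β⁻¹ / 2) with ha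
    have ha0 : 0 < a := by positivity
    refine ⟨a / (2 * (D + 1)), by positivity, ?_, ?_⟩
    · rw [show ((D : ℝ) + 1) * (2 * (a / (2 * (D + 1)))) = a by field_simp]
      exact min_le_left _ _
    · rw [show ((D : ℝ) + 1) * (2 * (a / (2 * (D + 1)))) = a by field_simp]
      calc H * (2 * a) ^ β ≤ H * (H⁻¹ ^ β⁻¹) ^ β := by
            gcongr
            have := min_le_right (τ / 400) (H⁻¹ ^ β⁻¹ / 2)
            linarith
        _ = 1 := by
            rw [← Real.rpow_mul (by positivity), inv_mul_cancel₀ hβ.ne', Real.rpow_one,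
              mul_inv_cancel₀ hH.ne']
  set B : ℝ := N * (100 * (D + 1) + 2) ^ D * (τ * (D + 1) / (50 * c) + 2) ^ D * 4 ^ D with hB
  have hB0 : 0 ≤ B := by positivity
  set L : ℝ := D + 1 + B with hL
  have hD0 : (0 : ℝ) ≤ D := Nat.cast_nonneg D
  refine ⟨(D + 1) ^ 2 + 6 + D + B, fun M R hM hR =>
    ⟨5 * L ^ 2 + c⁻¹ + R + (M * c⁻¹ + 2), ?_⟩⟩
  intro d hd 𝓜 hK h𝓜 hMb hreach hN ε hε hε1
  set q : ℝ := ε ^ β⁻¹ with hq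
  have hq0 : 0 < q := Real.rpow_pos_of_pos hε _
  have hq1 : q ≤ 1 := Real.rpow_le_one hε.le hε1.le (by positivity)
  have hqi : 1 ≤ q⁻¹ := (one_le_inv₀ hq0).2 hq1
  have hQ : ε ^ (-(d : ℝ) / β) = q⁻¹ ^ d := by
    rw [hq, ← Real.rpow_neg hε.le, ← Real.rpow_natCast, ← Real.rpow_mul hε.le]
    congr 1; field_simp
  have hQ2 : ε ^ (-(2 * (d : ℝ)) / β) = (q⁻¹ ^ d) ^ 2 := by
    rw [← hQ, ← Real.rpow_natCast, ← Real.rpow_mul hε.le]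
    congr 1; push_cast; ring
  have hd1 : (1 : ℝ) ≤ d := by exact_mod_cast hd
  obtain ⟨Λ, hΛ, hmem⟩ := exists_cells_of_isSmoothSubmanifold hτ hK h𝓜 hreach hN hc hq0 hq1
  rw [← hB] at hΛ
  rw [hQ, hQ2]
  set Q : ℝ := q⁻¹ ^ d with hQd
  -- Here `1 ≤ d` matters: the weight `δ⁻¹` of order `ε ^ (-1 / β)` is absorbed by `ε ^ (-d / β)`.
  have hqQ : q⁻¹ ≤ Q := le_self_pow₀ hqi (by omega)
  have hQ1 : 1 ≤ Q := hqi.trans hqQ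
  have hdQ : 1 ≤ d * Q := one_le_mul_of_one_le_of_one_le hd1 hQ1
  have hQdQ : Q ≤ d * Q := le_mul_of_one_le_left (by linarith) hd1
  have hdQ2 : d * Q ≤ (d : ℝ) ^ 2 * Q ^ 2 := by rw [← mul_pow]; exact le_self_pow₀ hdQ two_ne_zero
  have hl : ((D + Λ.card + 1 : ℕ) : ℝ) ≤ L * (d * Q) := by
    push_cast
    rw [hL]
    nlinarith
  have hlog : 0 ≤ Real.log d := Real.log_nonneg hd1
  have hlogε : 0 ≤ Real.log ε⁻¹ := Real.log_nonneg ((one_le_inv₀ hε).2 hε1.le)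
  have hδ : 0 < c * q := mul_pos hc hq0
  -- A sum of nonnegative terms, so that each of the four lower bounds on `κ` is met.
  set κ : ℝ := 5 * ((D + Λ.card + 1 : ℕ) : ℝ) ^ 2 + (c * q)⁻¹ + R + (M / (c * q) + 2) with hκ
  have hp1 : 0 ≤ 5 * ((D + Λ.card + 1 : ℕ) : ℝ) ^ 2 := by positivity
  have hp2 : 0 < (c * q)⁻¹ := inv_pos.2 hδ
  have hp3 : 0 < M / (c * q) := div_pos hM hδ
  obtain ⟨S, hS⟩ := exists_transformerClass_of_cells (η := ε) (κ := κ) hδ hR.le hMb hmem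
    (by linarith) (by linarith) (by linarith) (by linarith)
  have hsq : 0 ≤ ((D : ℝ) + 1) ^ 2 := sq_nonneg _
  have hLC : L * (d * Q) ≤ ((D + 1) ^ 2 + 6 + D + B) * (d * Q) := by
    gcongr
    rw [hL]
    linarith
  have hC0 : 0 ≤ ((D : ℝ) + 1) ^ 2 + 6 + D + B := by positivity
  -- The number of blocks and the feed-forward depth do not depend on `d` and `ε`; the logarithms
  -- are nonnegative and only relax the bounds.
  have hLT : ((2 : ℕ) : ℝ) ≤ ((D + 1) ^ 2 + 6 + D + B) * (1 + Real.log d) := by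
    refine le_trans ?_ (le_mul_of_one_le_right hC0 (by linarith))
    push_cast
    linarith
  have hLff : (((D + 1) ^ 2 + 3 : ℕ) : ℝ) ≤ ((D + 1) ^ 2 + 6 + D + B) * (1 + Real.log ε⁻¹) := by
    refine le_trans ?_ (le_mul_of_one_le_right hC0 (by linarith))
    push_cast
    linarith
  have hwff : (((D + 1) ^ 2 + 2 : ℕ) : ℝ) ≤ (D + 1) ^ 2 + 6 + D + B := by
    push_cast
    linarith
  have hemb : ((6 + D : ℕ) : ℝ) ≤ (D + 1) ^ 2 + 6 + D + B := by
    push_cast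
    linarith
  have hm : ((D + Λ.card : ℕ) : ℝ) ≤ ((D + 1) ^ 2 + 6 + D + B) * (d * Q) := by
    refine le_trans ?_ (hl.trans hLC)
    exact_mod_cast Nat.le_succ _
  have hκC : κ ≤ (5 * L ^ 2 + c⁻¹ + R + (M * c⁻¹ + 2)) * ((d : ℝ) ^ 2 * Q ^ 2) := by
    have e1 : ((D + Λ.card + 1 : ℕ) : ℝ) ^ 2 ≤ L ^ 2 * ((d : ℝ) ^ 2 * Q ^ 2) := by
      calc ((D + Λ.card + 1 : ℕ) : ℝ) ^ 2 ≤ (L * (d * Q)) ^ 2 := by gcongr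
        _ = _ := by ring
    have hq3 : q⁻¹ ≤ (d : ℝ) ^ 2 * Q ^ 2 := hqQ.trans (hQdQ.trans hdQ2)
    have e2 : (c * q)⁻¹ ≤ c⁻¹ * ((d : ℝ) ^ 2 * Q ^ 2) := by
      rw [mul_inv]
      gcongr
    have e3 : M / (c * q) ≤ M * c⁻¹ * ((d : ℝ) ^ 2 * Q ^ 2) := by
      rw [div_eq_mul_inv, mul_assoc]
      gcongr
    have e4 : 1 ≤ (d : ℝ) ^ 2 * Q ^ 2 := hdQ.trans hdQ2
    have e5 : R ≤ R * ((d : ℝ) ^ 2 * Q ^ 2) := le_mul_of_one_le_right hR.le e4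
    rw [hκ]
    linarith
  clear_value κ Q q B L
  refine ⟨cellParams D Λ.card R κ, S, hLT, hLff, hwff, hl.trans hLC, hemb, hm, hκC, rfl,
    fun f hf hfR => ?_⟩
  · obtain ⟨T, hT, -⟩ := h𝓜.exists_regularTangents
    refine hS f (fun x y hxy => ?_) hfR
    have h1 : ((D : ℝ) + 1) * (2 * (c * q)) = (D + 1) * (2 * c) * q := by ring
    have h2 := hf.abs_sub_le hH hβ hT hK (uniqueNearest_of_le_reach hreach) hτ x y
      (r := (D + 1) * (2 * (c * q))) (by
        rw [h1]
        exact (mul_le_of_le_one_right (by positivity) hq1).trans hcτ) hxy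
    refine h2.trans ?_
    have h3 : 2 * (((D : ℝ) + 1) * (2 * (c * q))) = 2 * ((D + 1) * (2 * c)) * q := by ring
    rw [h3, Real.mul_rpow (by positivity) hq0.le, hq, ← Real.rpow_mul hε.le,
      inv_mul_cancel₀ hβ.ne', Real.rpow_one, ← mul_assoc]
    exact mul_le_of_le_one_left hε.le hcH
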